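/- Let $r_M>0$ and let $r:(0,\infty)\times[0,r_M]\to\mathbb R$ be a rate function, measurable in $x$, such that $$0\le r(x,I)\le r_M \quad\text{for all } x>0,\ I\in[0,r_M],\qquad \frac{\partial r}{\partial I}\in L^\infty\big((0,\infty)\times(0,r_M)\big)$$ (where, for almost every $x$, $r(x,\cdot)$ is absolutely continuous on $[0,r_M]$, so that the pointwise derivative is the distributional one), and which is inhibitory: $$\frac{\partial r}{\partial I}(x,I)\le 0 \quad\text{for all } x>0,\ I\in[0,r_M] \text{ at which } \partial r/\partial I \text{ exists.}$$ Let $n_{\rm ini}\in L^1(0,\infty)$ satisfy $n_{\rm ini}\ge 0$ a.e. and $\int_0^\infty n_{\rm ini}(x)\,dx=1$. Then there exist a unique $n\in C([0,\infty);L^1(0,\infty))$ and a unique measurable activity $I:[0,\infty)\to[0,r_M]$ solving $$\begin{cases}\partial_t n(t,x)+\partial_x n(t,x)+r(x,I(t))\,n(t,x)=0,& t,x\ge 0,\\ I(t)=\int_0^\infty r(x,I(t))\,n(t,x)\,dx,& t\ge 0,\\ n(t,x=0)=I(t),\\ n(t=0)=n_{\rm ini},\end{cases}$$ that is, $I(t)=\int_0^\infty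 r(x,I(t))n(t,x)\,dx$ for every $t\ge0$, $n(0,\cdot)=n_{\rm ini}$ a.e., and the transport equation with its boundary and initial values holds in the weak sense: for every $\varphi\in C_c^\infty(\mathbb R^2)$, $$\int_0^\infty\!\!\int_0^\infty n\,\big(\partial_t\varphi+\partial_x\varphi-r(x,I(t))\varphi\big)\,dx\,dt+\int_0^\infty n_{\rm ini}(x)\varphi(0,x)\,dx+\int_0^\infty I(t)\varphi(t,0)\,dt=0 .$$ -/

import Mathlib

open MeasureTheory Set
open scoped NNReal ENNReal ContDiff

namespace TimeElapsed

/-- Lebesgue measure on the half line `(0, ∞)` of ages. -/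
noncomputable abbrev ageMeasure : Measure ℝ := volume.restrict (Ioi (0 : ℝ))

/-- The Banach space `L¹(0, ∞)`. -/
abbrev L1Age : Type := Lp ℝ 1 ageMeasure

/-- The partial derivative `∂r/∂I (x, I)` on the activity interval `[0, rM]` (one-sided at the two
endpoints). -/
noncomputable def activityDeriv (r : ℝ → ℝ → ℝ) (rM x I : ℝ) : ℝ :=
  derivWithin (r x) (Icc 0 rM) I

/-- The standing assumption on the discharge rate `r(x, I)`, `x > 0`, `0 ≤ I ≤ rM`:
`0 ≤ r ≤ rM` and `∂r/∂I ∈ L^∞((0, ∞) × (0, rM))`.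
Only the values of `r` on `(0, ∞) × [0, rM]` are used. -/
structure IsBoundedRate (r : ℝ → ℝ → ℝ) (rM : ℝ) : Prop where
  /-- `r(·, I)` is measurable on `(0, ∞)` for every activity level `I`. -/
  measurable : ∀ I ∈ Icc 0 rM, AEStronglyMeasurable (fun x => r x I) ageMeasure
  /-- `0 ≤ r(x, I) ≤ rM`. -/
  mem_Icc : ∀ x ∈ Ioi (0 : ℝ), ∀ I ∈ Icc 0 rM, r x I ∈ Icc 0 rM
  /-- `r(x, ·)` is absolutely continuous, so that it is differentiable almost everywhere and its
  pointwise derivative is its derivative in the sense of distributions. -/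
  absolutelyContinuous : ∀ᵐ x ∂ageMeasure, AbsolutelyContinuousOnInterval (r x) 0 rM
  /-- `∂r/∂I` is essentially bounded on `(0, ∞) × (0, rM)`. -/
  deriv_memLp : MemLp (fun p : ℝ × ℝ => activityDeriv r rM p.1 p.2) ∞
    (volume.restrict (Ioi (0 : ℝ) ×ˢ Ioo 0 rM))

/-- The connections are inhibitory: `∂r/∂I (x, I) ≤ 0` for `x > 0` and `0 ≤ I ≤ rM`. -/
def IsInhibitory (r : ℝ → ℝ → ℝ) (rM : ℝ) : Prop :=
  ∀ x ∈ Ioi (0 : ℝ), ∀ I ∈ Icc 0 rM, activityDeriv r rM x I ≤ 0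

/-- `(n, I)` solves the time-elapsed model without delay
`∂ₜn + ∂ₓn + r(x, I(t)) n = 0`, `I(t) = ∫ r(x, I(t)) n(t, x) dx`, `n(t, 0) = I(t)`,
`n(0, ·) = nIni`, where `n ∈ C([0, ∞); L¹(0, ∞))`.  The transport equation, with its boundary
and initial values, holds in the sense of distributions on `[0, ∞) × [0, ∞)`. -/
structure IsSolution (r : ℝ → ℝ → ℝ) (rM : ℝ) (nIni : ℝ → ℝ)
    (n : C(ℝ≥0, L1Age)) (I : ℝ≥0 → ℝ) : Prop where
  activity_measurable : Measurable I
  /-- The activity takes its values in the interval on which the rate is defined. -/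
  activity_mem_Icc : ∀ t, I t ∈ Icc 0 rM
  /-- `I(t) = ∫ r(x, I(t)) n(t, x) dx` at every time `t ≥ 0`. -/
  activity_eq : ∀ t, I t = ∫ x in Ioi (0 : ℝ), r x (I t) * n t x
  /-- `n(0, ·) = nIni`. -/
  initial : n 0 =ᵐ[ageMeasure] nIni
  /-- The weak form, tested against smooth compactly supported functions `φ(t, x)` that need not
  vanish on `{t = 0}` or `{x = 0}`; here `fderiv ℝ φ (t, x) (1, 1)` is `∂ₜφ + ∂ₓφ`. -/
  transport : ∀ φ : ℝ × ℝ → ℝ, ContDiff ℝ ∞ φ → HasCompactSupport φ →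
    (∫ t in Ioi (0 : ℝ), ∫ x in Ioi (0 : ℝ),
        n t.toNNReal x * (fderiv ℝ φ (t, x) (1, 1) - r x (I t.toNNReal) * φ (t, x)))
      + (∫ x in Ioi (0 : ℝ), nIni x * φ (0, x))
      + (∫ t in Ioi (0 : ℝ), I t.toNNReal * φ (t, 0)) = 0

end TimeElapsed

/-!
The equation is rewritten along the characteristics `x = y + t`. For a prescribed activity `I`, the
population is explicit there (`charDensity`): the neurons entering on a characteristic, initially
(`y > 0`) or at age zero and time `-y` (`y ≤ 0`), multiplied by the fraction `survival` of those
which have not discharged yet. Fubini and the fundamental theorem of calculus for absolutely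
continuous functions on each characteristic show that this population satisfies the weak
formulation (`weakFormulation_charDensity`) and the mass balance (`integral_charDensity`).

The rate enters only through `exists_isRegularRate`: for almost every age it is nonincreasing and
uniformly Lipschitz in the activity. Inhibition is what makes the implicit equation
`I = ∫ r(x, I) n(x) dx` solvable: its right-hand side is nonincreasing in `I` if `n ≥ 0`, so there
is exactly one solution, and it is a Lipschitz function of `n ∈ L¹`
(`abs_fixedPoint_sub_le_of_antitone`).

*Existence.* The map from an activity to the population it drives, and from this population to the
solution of `I = min rM (∫ r(x, I) n dx)`, is a Volterra map with a Lipschitz constant growing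
linearly in time, hence has a fixed point (`exists_fixedPoint_of_volterra`). The cap `rM` makes the
map well defined whatever the mass. At the fixed point at least `I` is discharged at all times, so
the mass, initially one, does not increase and the cap is inactive
(`exists_selfConsistent_activity`).

*Uniqueness.* Any solution is compared with the constructed one, which is nonnegative with mass at
most one; nothing of the kind is known a priori of the other one. Testing with `χ(t) η(x - t)` gives
an ordinary differential equation, in the weak sense, for `∫ η(x - t) n(t, x) dx`
(`IsSolution.pairing_eq`). The supremum over `|η| ≤ 1` of the difference of two such identities
bounds the `L¹` distance `D` of the solutions by `D(t) ≤ K ∫₀ᵗ D`, and Grönwall's inequality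
concludes. This duality avoids jointly measurable representatives of `n`.
-/

namespace TimeElapsed

open Filter Topology

variable {ρ : ℝ → ℝ → ℝ} {rM L : ℝ}

/-! ### Regular rates -/

/-- A discharge rate in normal form: it is defined for all real ages and activities, jointly
measurable, with values in `[0, rM]`, nonincreasing and `L`-Lipschitz in the activity at *every*
age, and vanishing at nonpositive ages. -/
structure IsRegularRate (ρ : ℝ → ℝ → ℝ) (rM L : ℝ) : Prop where
  measurable : Measurable (Function.uncurry ρ)
  nonneg : ∀ x z, 0 ≤ ρ x z
  le : ∀ x z, ρ x z ≤ rM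
  antitone : ∀ x, Antitone (ρ x)
  lipschitz : ∀ x z w, |ρ x z - ρ x w| ≤ L * |z - w|
  eq_zero : ∀ x ≤ 0, ∀ z, ρ x z = 0

/-- By Fubini, the essential bound on `∂r/∂I` holds on almost every line `{x} × (0, rM)`; absolute
continuity integrates it, and the sign condition, along the line. -/
theorem ae_antitoneOn_and_lipschitz {r : ℝ → ℝ → ℝ} {rM : ℝ}
    (hr : IsBoundedRate r rM) (hinh : IsInhibitory r rM) :
    ∃ L : ℝ, 0 ≤ L ∧ ∀ᵐ x ∂ageMeasure, AntitoneOn (r x) (Icc 0 rM) ∧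
      ∀ z ∈ Icc 0 rM, ∀ w ∈ Icc 0 rM, |r x z - r x w| ≤ L * |z - w| := by
  obtain ⟨hm, hfin⟩ := hr.deriv_memLp
  set L := (eLpNorm (fun p : ℝ × ℝ => activityDeriv r rM p.1 p.2) ∞
    (volume.restrict (Ioi (0 : ℝ) ×ˢ Ioo 0 rM))).toReal with hL
  refine ⟨L, ENNReal.toReal_nonneg, ?_⟩
  have hbound : ∀ᵐ p ∂((ageMeasure).prod (volume.restrict (Ioo 0 rM))),
      ‖activityDeriv r rM p.1 p.2‖ ≤ L := by
    rw [ageMeasure, Measure.prod_restrict, ← Measure.volume_eq_prod]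
    filter_upwards [ae_le_eLpNormEssSup
      (f := fun p : ℝ × ℝ => activityDeriv r rM p.1 p.2)
      (μ := volume.restrict (Ioi (0 : ℝ) ×ˢ Ioo 0 rM))] with p hp
    rw [← toReal_enorm]
    refine ENNReal.toReal_mono hfin.ne ?_
    rw [eLpNorm_exponent_top]
    exact hp
  filter_upwards [Measure.ae_ae_of_ae_prod hbound, hr.absolutelyContinuous,
    ae_restrict_mem measurableSet_Ioi] with x hx hac hx0
  have hderiv : ∀ z ∈ Ioo 0 rM, deriv (r x) z = activityDeriv r rM x z := fun z hz =>
    (derivWithin_of_mem_nhds (Icc_mem_nhds hz.1 hz.2)).symm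
  have hae : ∀ᵐ z, z ∈ Ioo 0 rM → ‖deriv (r x) z‖ ≤ L := by
    filter_upwards [ae_imp_of_ae_restrict hx] with z hz hz'
    rw [hderiv z hz']
    exact hz hz'
  have key : ∀ z ∈ Icc 0 rM, ∀ w ∈ Icc 0 rM, z ≤ w →
      r x w ≤ r x z ∧ |r x w - r x z| ≤ L * |w - z| := by
    intro z hz w hw hzw
    have hrM : 0 ≤ rM := hz.1.trans hz.2
    have hac' : AbsolutelyContinuousOnInterval (r x) z w := by
      refine hac.mono ?_
      rw [uIcc_of_le hzw, uIcc_of_le hrM]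
      exact Icc_subset_Icc hz.1 hw.2
    have hsub : Ioo z w ⊆ Ioo 0 rM := Ioo_subset_Ioo hz.1 hw.2
    constructor
    · have h : ∫ t in z..w, deriv (r x) t ≤ 0 := by
        rw [intervalIntegral.integral_of_le hzw, integral_Ioc_eq_integral_Ioo]
        refine setIntegral_nonpos measurableSet_Ioo fun t ht => ?_
        rw [hderiv t (hsub ht)]
        exact hinh x hx0 t (Ioo_subset_Icc_self (hsub ht))
      rw [hac'.integral_deriv_eq_sub] at h
      linarith
    · rw [← hac'.integral_deriv_eq_sub, ← Real.norm_eq_abs]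
      refine intervalIntegral.norm_integral_le_of_norm_le_const_ae ?_
      have hw' : ∀ᵐ t, t ≠ w := by simp [ae_iff, measure_singleton]
      filter_upwards [hae, hw'] with t ht htw ht'
      rw [uIoc_of_le hzw] at ht'
      exact ht (hsub ⟨ht'.1, lt_of_le_of_ne ht'.2 htw⟩)
  refine ⟨fun z hz w hw hzw => (key z hz w hw hzw).1, fun z hz w hw => ?_⟩
  rcases le_total z w with h | h
  · rw [abs_sub_comm, abs_sub_comm z]
    exact (key z hz w hw h).2
  · exact (key w hw z hz h).2

/-- Off a null set of ages, a bounded inhibitory rate agrees with a regular one. -/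
theorem exists_isRegularRate {r : ℝ → ℝ → ℝ} {rM : ℝ} (hrM : 0 ≤ rM)
    (hr : IsBoundedRate r rM) (hinh : IsInhibitory r rM) :
    ∃ (ρ : ℝ → ℝ → ℝ) (L : ℝ), 0 ≤ L ∧ IsRegularRate ρ rM L ∧
      ∀ᵐ x ∂ageMeasure, ∀ z ∈ Icc 0 rM, r x z = ρ x z := by
  obtain ⟨L, hL0, hL⟩ := ae_antitoneOn_and_lipschitz hr hinh
  let q : ℕ → Icc 0 rM :=
    haveI : Nonempty (Icc 0 rM) := ⟨⟨0, le_rfl, hrM⟩⟩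
    TopologicalSpace.denseSeq (Icc 0 rM)
  have hq : DenseRange q :=
    haveI : Nonempty (Icc 0 rM) := ⟨⟨0, le_rfl, hrM⟩⟩
    TopologicalSpace.denseRange_denseSeq (Icc 0 rM)
  -- `g k` is a measurable representative of `r(·, q k)`, for `q` dense in `[0, rM]`
  let g : ℕ → ℝ → ℝ := fun k => (hr.measurable (q k) (q k).2).mk _
  have hg : ∀ k, Measurable (g k) := fun k =>
    (hr.measurable (q k) (q k).2).stronglyMeasurable_mk.measurable
  have hgr : ∀ᵐ x ∂ageMeasure, ∀ k, r x (q k) = g k x :=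
    ae_all_iff.2 fun k => (hr.measurable (q k) (q k).2).ae_eq_mk
  have hgood := (hL.and hgr).and (ae_restrict_mem (μ := volume) (measurableSet_Ioi (a := (0:ℝ))))
  obtain ⟨G, hGsub, hGm, hGnull⟩ :
      ∃ G : Set ℝ, (∀ x ∈ G, ((AntitoneOn (r x) (Icc 0 rM) ∧
        ∀ z ∈ Icc 0 rM, ∀ w ∈ Icc 0 rM, |r x z - r x w| ≤ L * |z - w|) ∧
        ∀ k, r x (q k) = g k x) ∧ x ∈ Ioi (0:ℝ)) ∧ MeasurableSet G ∧ ∀ᵐ x ∂ageMeasure, x ∈ G := by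
    obtain ⟨G, h1, h2, h3⟩ := (hgood.exists_measurable_mem)
    exact ⟨G, fun x hx => h3 x hx, h2, h1⟩
  let p : ℝ → Icc 0 rM := projIcc 0 rM hrM
  have hp : ∀ z w, |(p z : ℝ) - p w| ≤ |z - w| := fun z w => by
    have := (LipschitzWith.projIcc hrM).dist_le_mul z w
    rw [Subtype.dist_eq, Real.dist_eq, Real.dist_eq] at this
    simpa using this
  classical
  -- keep the rate on a measurable set of good ages, and extend it to all activities by clamping
  let ρ : ℝ → ℝ → ℝ := fun x z => if x ∈ G then r x (p z) else 0
  have hcont : ∀ x ∈ G, Continuous fun z : Icc 0 rM => r x z := by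
    intro x hx
    have : LipschitzWith L.toNNReal fun z : Icc 0 rM => r x z := by
      refine LipschitzWith.of_dist_le_mul fun z w => ?_
      rw [Real.dist_eq, Subtype.dist_eq, Real.dist_eq, Real.coe_toNNReal _ hL0]
      exact (hGsub x hx).1.1.2 z z.2 w w.2
    exact this.continuous
  have hmeas : ∀ z : Icc 0 rM, Measurable fun x => if x ∈ G then r x z else 0 := by
    intro z
    obtain ⟨u, hu, hlim⟩ := mem_closure_iff_seq_limit.1 (hq z)
    choose k hk using hu
    refine measurable_of_tendsto_metrizable
      (f := fun n x => if x ∈ G then g (k n) x else 0)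
      (fun n => (hg _).ite hGm measurable_const) ?_
    rw [tendsto_pi_nhds]
    intro x
    by_cases hx : x ∈ G
    · simp only [hx, if_true]
      have := ((hcont x hx).tendsto z).comp hlim
      refine this.congr fun n => ?_
      simp only [Function.comp_apply]
      rw [← hk n]
      exact (hGsub x hx).1.2 (k n)
    · simp [hx]
  refine ⟨ρ, L, hL0, ⟨?_, ?_, ?_, ?_, ?_, ?_⟩, ?_⟩
  · have h : Measurable (Function.uncurry fun (z : Icc 0 rM) (x : ℝ) =>
        if x ∈ G then r x z else 0) := by
      refine measurable_uncurry_of_continuous_of_measurable (fun x => ?_) hmeas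
      by_cases hx : x ∈ G
      · simpa [hx] using hcont x hx
      · simpa [hx] using continuous_const
    have hp' : Measurable p := continuous_projIcc.measurable
    exact h.comp ((hp'.comp measurable_snd).prodMk measurable_fst)
  · intro x z
    by_cases hx : x ∈ G
    · simpa [ρ, hx] using (hr.mem_Icc x (hGsub x hx).2 (p z) (p z).2).1
    · simp [ρ, hx]
  · intro x z
    by_cases hx : x ∈ G
    · simpa [ρ, hx] using (hr.mem_Icc x (hGsub x hx).2 (p z) (p z).2).2
    · simpa [ρ, hx] using hrM
  · intro x z w hzw
    by_cases hx : x ∈ G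
    · simpa [ρ, hx] using (hGsub x hx).1.1.1 (p z).2 (p w).2 (monotone_projIcc hrM hzw)
    · simp [ρ, hx]
  · intro x z w
    by_cases hx : x ∈ G
    · simp only [ρ, hx, if_true]
      exact ((hGsub x hx).1.1.2 _ (p z).2 _ (p w).2).trans
        (mul_le_mul_of_nonneg_left (hp z w) hL0)
    · simp only [ρ, hx, if_false, sub_self, abs_zero]
      positivity
  · intro x hx z
    have : x ∉ G := fun h => absurd (hGsub x h).2 (not_lt.2 hx)
    simp [ρ, this]
  · filter_upwards [hGnull] with x hx z hz
    simp [ρ, hx, p, projIcc_of_mem hrM hz]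

/-- Solutions only depend on the values of the rate off a null set of ages. -/
theorem IsSolution.congr_rate {r ρ : ℝ → ℝ → ℝ} {rM : ℝ} {nIni : ℝ → ℝ} {n : C(ℝ≥0, L1Age)}
    {I : ℝ≥0 → ℝ} (h : ∀ᵐ x ∂ageMeasure, ∀ z ∈ Icc 0 rM, r x z = ρ x z)
    (hs : IsSolution r rM nIni n I) : IsSolution ρ rM nIni n I where
  activity_measurable := hs.activity_measurable
  activity_mem_Icc := hs.activity_mem_Icc
  activity_eq t := by
    refine (hs.activity_eq t).trans (integral_congr_ae ?_)
    filter_upwards [h] with x hx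
    rw [hx _ (hs.activity_mem_Icc t)]
  initial := hs.initial
  transport φ hφ hc := by
    refine Eq.trans ?_ (hs.transport φ hφ hc)
    refine congrArg₂ _ (congrArg₂ _ ?_ rfl) rfl
    refine integral_congr_ae (Eventually.of_forall fun t => integral_congr_ae ?_)
    filter_upwards [h] with x hx
    rw [hx _ (hs.activity_mem_Icc _)]

/-! ### Discharge and activity of a population -/

theorem IsRegularRate.rM_nonneg (hρ : IsRegularRate ρ rM L) : 0 ≤ rM :=
  (hρ.nonneg 0 0).trans (hρ.le 0 0)

theorem IsRegularRate.abs_le (hρ : IsRegularRate ρ rM L) (x z : ℝ) : |ρ x z| ≤ rM := by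
  rw [abs_of_nonneg (hρ.nonneg x z)]
  exact hρ.le x z

theorem IsRegularRate.measurable_left (hρ : IsRegularRate ρ rM L) (z : ℝ) :
    Measurable fun x => ρ x z :=
  hρ.measurable.comp (measurable_id.prodMk measurable_const)

/-- The total discharge rate of the population `f` when the activity is `z`. -/
noncomputable def discharge (ρ : ℝ → ℝ → ℝ) (z : ℝ) (f : L1Age) : ℝ :=
  ∫ x in Ioi (0 : ℝ), ρ x z * f x

theorem integrable_bounded_mul {w : ℝ → ℝ} {C : ℝ} (hw : AEStronglyMeasurable w ageMeasure)
    (hC : ∀ x, |w x| ≤ C) (f : L1Age) : Integrable (fun x => w x * f x) ageMeasure :=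
  (L1.integrable_coeFn f).bdd_mul hw (Eventually.of_forall hC)

theorem abs_integral_bounded_mul_le {w : ℝ → ℝ} {C : ℝ} (hC : ∀ x, |w x| ≤ C) (f : L1Age) :
    |∫ x in Ioi (0 : ℝ), w x * f x| ≤ C * ‖f‖ := by
  rw [L1.norm_eq_integral_norm, ← integral_const_mul, ← Real.norm_eq_abs]
  refine norm_integral_le_of_norm_le ((L1.integrable_coeFn f).norm.const_mul C)
    (Eventually.of_forall fun x => ?_)
  rw [norm_mul]
  exact mul_le_mul_of_nonneg_right (hC x) (norm_nonneg _)

theorem integral_bounded_mul_sub {w : ℝ → ℝ} {C : ℝ} (hw : AEStronglyMeasurable w ageMeasure)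
    (hC : ∀ x, |w x| ≤ C) (f g : L1Age) :
    ∫ x in Ioi (0 : ℝ), w x * (f - g : L1Age) x =
      (∫ x in Ioi (0 : ℝ), w x * f x) - ∫ x in Ioi (0 : ℝ), w x * g x := by
  rw [← integral_sub (integrable_bounded_mul hw hC f) (integrable_bounded_mul hw hC g)]
  refine integral_congr_ae ?_
  filter_upwards [Lp.coeFn_sub f g] with x hx
  rw [hx, Pi.sub_apply, mul_sub]

theorem abs_discharge_sub_le (hρ : IsRegularRate ρ rM L) (z : ℝ) (f g : L1Age) :
    |discharge ρ z f - discharge ρ z g| ≤ rM * ‖f - g‖ := by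
  rw [discharge, discharge, ← integral_bounded_mul_sub
    (hρ.measurable_left z).aestronglyMeasurable (fun x => hρ.abs_le x z)]
  exact abs_integral_bounded_mul_le (fun x => hρ.abs_le x z) _

theorem abs_discharge_sub_discharge_le (hρ : IsRegularRate ρ rM L) (z w : ℝ) (f : L1Age) :
    |discharge ρ z f - discharge ρ w f| ≤ L * |z - w| * ‖f‖ := by
  rw [discharge, discharge, ← integral_sub
    (integrable_bounded_mul (hρ.measurable_left z).aestronglyMeasurable (fun x => hρ.abs_le x z) f)
    (integrable_bounded_mul (hρ.measurable_left w).aestronglyMeasurable (fun x => hρ.abs_le x w) f)]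
  simp_rw [← sub_mul]
  exact abs_integral_bounded_mul_le (fun x => hρ.lipschitz x z w) f

theorem continuous_discharge (hρ : IsRegularRate ρ rM L) (f : L1Age) :
    Continuous fun z => discharge ρ z f := by
  refine continuous_iff_continuousAt.2 fun w => tendsto_iff_norm_sub_tendsto_zero.2 ?_
  refine squeeze_zero (fun _ => norm_nonneg _)
    (fun z => abs_discharge_sub_discharge_le hρ z w f) ?_
  have : Continuous fun z : ℝ => L * |z - w| * ‖f‖ := by fun_prop
  simpa using this.tendsto w

theorem antitone_discharge (hρ : IsRegularRate ρ rM L) {f : L1Age}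
    (hf : ∀ᵐ x ∂ageMeasure, 0 ≤ f x) : Antitone fun z => discharge ρ z f := by
  intro z w hzw
  refine integral_mono_ae
    (integrable_bounded_mul (hρ.measurable_left w).aestronglyMeasurable (fun x => hρ.abs_le x w) f)
    (integrable_bounded_mul (hρ.measurable_left z).aestronglyMeasurable (fun x => hρ.abs_le x z) f)
    ?_
  filter_upwards [hf] with x hx
  exact mul_le_mul_of_nonneg_right (hρ.antitone x hzw) hx

theorem discharge_nonneg (hρ : IsRegularRate ρ rM L) {f : L1Age}
    (hf : ∀ᵐ x ∂ageMeasure, 0 ≤ f x) (z : ℝ) : 0 ≤ discharge ρ z f := by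
  refine integral_nonneg_of_ae ?_
  filter_upwards [hf] with x hx
  exact mul_nonneg (hρ.nonneg x z) hx

/-- Inhibition makes the activity a Lipschitz function of the population: the fixed points of an
antitone function move by at most its perturbation. -/
theorem abs_fixedPoint_sub_le_of_antitone {A B : ℝ → ℝ} {ε z w : ℝ} (hA : Antitone A)
    (hAB : ∀ u, |A u - B u| ≤ ε) (hz : z = A z) (hw : w = B w) : |z - w| ≤ ε := by
  have h1 := abs_le.1 (hAB w)
  rcases le_total z w with h | h
  · have := hA h
    rw [abs_sub_comm, abs_of_nonneg (sub_nonneg.2 h)]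
    linarith
  · have := hA h
    rw [abs_of_nonneg (sub_nonneg.2 h)]
    linarith

/-- The cap at `rM` makes the activity well defined for nonnegative populations of any mass. -/
theorem exists_cappedActivity (hρ : IsRegularRate ρ rM L) {f : L1Age}
    (hf : ∀ᵐ x ∂ageMeasure, 0 ≤ f x) :
    ∃ z ∈ Icc 0 rM, z = min rM (discharge ρ z f) := by
  have hc : ContinuousOn (fun z => min rM (discharge ρ z f) - z) (Icc 0 rM) :=
    ((continuous_const.min (continuous_discharge hρ f)).sub continuous_id).continuousOn
  have h0 : (0 : ℝ) ∈ Icc (min rM (discharge ρ rM f) - rM) (min rM (discharge ρ 0 f) - 0) := by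
    refine ⟨by linarith [min_le_left rM (discharge ρ rM f)], ?_⟩
    rw [sub_zero]
    exact le_min hρ.rM_nonneg (discharge_nonneg hρ hf 0)
  obtain ⟨z, hz, hz'⟩ := intermediate_value_Icc' hρ.rM_nonneg hc h0
  exact ⟨z, hz, by simp only at hz'; linarith⟩

theorem antitone_min_discharge (hρ : IsRegularRate ρ rM L) {f : L1Age}
    (hf : ∀ᵐ x ∂ageMeasure, 0 ≤ f x) : Antitone fun z => min rM (discharge ρ z f) :=
  antitone_const.min (antitone_discharge hρ hf)

theorem abs_min_discharge_sub_le (hρ : IsRegularRate ρ rM L) (z : ℝ) (f g : L1Age) :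
    |min rM (discharge ρ z f) - min rM (discharge ρ z g)| ≤ rM * ‖f - g‖ := by
  refine (abs_min_sub_min_le_max _ _ _ _).trans ?_
  rw [sub_self, abs_zero]
  exact max_le (mul_nonneg hρ.rM_nonneg (norm_nonneg _)) (abs_discharge_sub_le hρ z f g)

/-! ### Volterra maps have fixed points -/

theorem intervalIntegrable_comp_toNNReal {u : ℝ≥0 → ℝ} (hu : Continuous u) (a b : ℝ) :
    IntervalIntegrable (fun s : ℝ => u s.toNNReal) volume a b :=
  (hu.comp continuous_real_toNNReal).intervalIntegrable a b

/-- For `s ≤ t` one has `(t + t²) - (s + s²) ≥ (1 + t) (t - s)`, so the weight decays away from `t`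
at least like an exponential of rate `l (1 + t)`. -/
theorem integral_exp_weight_le {l : ℝ} (hl : 0 < l) {t : ℝ} (ht : 0 ≤ t) :
    (1 + t) * ∫ s in (0 : ℝ)..t, Real.exp (l * (s + s ^ 2)) ≤ Real.exp (l * (t + t ^ 2)) / l := by
  have hc : 0 < l * (1 + t) := by positivity
  have h1 : ∫ s in (0 : ℝ)..t, Real.exp (l * (s + s ^ 2)) ≤
      ∫ s in (0 : ℝ)..t, Real.exp (l * t ^ 2 - l * t * t) * Real.exp (l * (1 + t) * s) := by
    refine intervalIntegral.integral_mono_on ht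
      (Continuous.intervalIntegrable (by fun_prop) _ _)
      (Continuous.intervalIntegrable (by fun_prop) _ _) fun s hs => ?_
    rw [← Real.exp_add, Real.exp_le_exp]
    have : 0 ≤ l * (s * (t - s)) := by
      have := sub_nonneg.2 hs.2
      have := hs.1
      positivity
    nlinarith
  have h2 : ∫ s in (0 : ℝ)..t, Real.exp (l * (1 + t) * s) =
      (l * (1 + t))⁻¹ * (Real.exp (l * (1 + t) * t) - 1) := by
    rw [intervalIntegral.integral_comp_mul_left (fun x => Real.exp x) hc.ne']
    simp
  rw [intervalIntegral.integral_const_mul, h2] at h1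
  have h3 : Real.exp (l * t ^ 2 - l * t * t) = 1 := by
    rw [← Real.exp_zero]; ring_nf
  rw [h3, one_mul] at h1
  calc (1 + t) * ∫ s in (0 : ℝ)..t, Real.exp (l * (s + s ^ 2))
      ≤ (1 + t) * ((l * (1 + t))⁻¹ * (Real.exp (l * (1 + t) * t) - 1)) := by gcongr
    _ = (Real.exp (l * (1 + t) * t) - 1) / l := by field_simp
    _ ≤ Real.exp (l * (t + t ^ 2)) / l := by
      gcongr
      have : l * (1 + t) * t = l * (t + t ^ 2) := by ring
      rw [this]
      linarith

/-- A bounded causal map with a Lipschitz constant growing linearly in time has a fixed point: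
it is a contraction for the supremum norm with weight `exp (-l (t + t²))`, `l` large. -/
theorem exists_fixedPoint_of_volterra (Φ : C(ℝ≥0, ℝ) → C(ℝ≥0, ℝ)) {M C : ℝ} (hC : 0 < C)
    (hM : ∀ u t, |Φ u t| ≤ M)
    (hΦ : ∀ u v (t : ℝ≥0), |Φ u t - Φ v t| ≤
      C * (1 + t) * ∫ s in (0 : ℝ)..t, |u s.toNNReal - v s.toNNReal|) :
    ∃ u, Φ u = u := by
  let l : ℝ := 2 * C
  have hl : 0 < l := by positivity
  let W : C(ℝ≥0, ℝ) := ⟨fun t => Real.exp (l * (t + (t : ℝ) ^ 2)), by fun_prop⟩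
  let V : C(ℝ≥0, ℝ) := ⟨fun t => Real.exp (-(l * (t + (t : ℝ) ^ 2))), by fun_prop⟩
  have hWV : ∀ t, W t * V t = 1 := fun t => by
    change Real.exp _ * Real.exp _ = 1
    rw [← Real.exp_add, add_neg_cancel, Real.exp_zero]
  have hV0 : ∀ t, 0 < V t := fun t => Real.exp_pos _
  have hW0 : ∀ t, 0 < W t := fun t => Real.exp_pos _
  have hV1 : ∀ t, V t ≤ 1 := fun t => by
    change Real.exp _ ≤ 1
    rw [Real.exp_le_one_iff]
    have : 0 ≤ l * (t + (t : ℝ) ^ 2) := by positivity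
    linarith
  let Ψ : BoundedContinuousFunction ℝ≥0 ℝ → BoundedContinuousFunction ℝ≥0 ℝ := fun u =>
    BoundedContinuousFunction.ofNormedAddCommGroup (fun t => V t * Φ (W * u.toContinuousMap) t)
      (by fun_prop) M (fun t => by
        rw [norm_mul, Real.norm_of_nonneg (hV0 t).le]
        calc V t * ‖Φ (W * u.toContinuousMap) t‖ ≤ 1 * ‖Φ (W * u.toContinuousMap) t‖ := by
              gcongr; exact hV1 t
          _ ≤ M := by rw [one_mul]; exact hM _ _)
  have hΨ : ContractingWith (1 / 2) Ψ := by
    refine ⟨by rw [div_lt_one (by norm_num)]; norm_num, LipschitzWith.of_dist_le_mul fun u v => ?_⟩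
    rw [BoundedContinuousFunction.dist_le (by positivity)]
    intro t
    have hint : ∫ s in (0 : ℝ)..t, |(W * u.toContinuousMap) s.toNNReal
        - (W * v.toContinuousMap) s.toNNReal| ≤
        ∫ s in (0 : ℝ)..t, Real.exp (l * (s + s ^ 2)) * dist u v := by
      refine intervalIntegral.integral_mono_on t.2 ?_
        (Continuous.intervalIntegrable (by fun_prop) _ _) fun s hs => ?_
      · exact intervalIntegrable_comp_toNNReal
          (u := fun s => |(W * u.toContinuousMap) s - (W * v.toContinuousMap) s|) (by fun_prop) _ _
      · have : Real.exp (l * (s + s ^ 2)) = W s.toNNReal := by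
          change _ = Real.exp (l * (_ + (_ : ℝ) ^ 2))
          rw [Real.coe_toNNReal _ hs.1]
        rw [this, ContinuousMap.mul_apply, ContinuousMap.mul_apply, ← mul_sub, abs_mul,
          abs_of_pos (hW0 _)]
        have hd : |u s.toNNReal - v s.toNNReal| ≤ dist u v :=
          BoundedContinuousFunction.dist_coe_le_dist (f := u) (g := v) _
        exact mul_le_mul_of_nonneg_left hd (hW0 _).le
    rw [intervalIntegral.integral_mul_const] at hint
    have h1 := integral_exp_weight_le hl t.2
    have h2 := hΦ (W * u.toContinuousMap) (W * v.toContinuousMap) t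
    change dist (V t * _) (V t * _) ≤ _
    rw [Real.dist_eq, ← mul_sub, abs_mul, abs_of_pos (hV0 t)]
    calc V t * |Φ (W * u.toContinuousMap) t - Φ (W * v.toContinuousMap) t|
        ≤ V t * (C * (1 + t) * ((∫ s in (0 : ℝ)..t, Real.exp (l * (s + s ^ 2))) * dist u v)) := by
          have := hV0 t
          refine mul_le_mul_of_nonneg_left (h2.trans ?_) this.le
          gcongr
      _ = V t * C * dist u v * ((1 + t) * ∫ s in (0 : ℝ)..t, Real.exp (l * (s + s ^ 2))) := by ring
      _ ≤ V t * C * dist u v * (W t / l) := by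
          have := hV0 t
          exact mul_le_mul_of_nonneg_left h1 (by positivity)
      _ = (W t * V t) * (C / l) * dist u v := by ring
      _ = 1 / 2 * dist u v := by
          rw [hWV, one_mul]
          congr 1
          simp only [l]
          field_simp
  have hfix := hΨ.fixedPoint_isFixedPt
  set u := hΨ.fixedPoint Ψ
  refine ⟨W * u.toContinuousMap, ?_⟩
  ext t
  have h : V t * Φ (W * u.toContinuousMap) t = u t := congrArg (fun f => f t) hfix
  calc Φ (W * u.toContinuousMap) t = (W t * V t) * Φ (W * u.toContinuousMap) t := by
        rw [hWV, one_mul]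
    _ = W t * (V t * Φ (W * u.toContinuousMap) t) := by ring
    _ = (W * u.toContinuousMap) t := by rw [h]; rfl

/-! ### Absolutely continuous functions -/

/-- The fundamental theorem of calculus on a half line, for a locally absolutely continuous function
with support bounded above. -/
theorem integral_Ioi_of_ae_hasDerivAt_of_eq_zero {f f' : ℝ → ℝ} {a R : ℝ}
    (hac : ∀ b, a ≤ b → AbsolutelyContinuousOnInterval f a b)
    (hderiv : ∀ᵐ t, a < t → HasDerivAt f (f' t) t) (hzero : ∀ t, R ≤ t → f t = 0) :
    ∫ t in Ioi a, f' t = -f a := by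
  set b := max R a
  have hab : a ≤ b := le_max_right _ _
  have h1 : ∫ t in Ioc a b, f' t = ∫ t in Ioi a, f' t := by
    refine (setIntegral_eq_of_subset_of_ae_sdiff_eq_zero measurableSet_Ioi.nullMeasurableSet
      Ioc_subset_Ioi_self ?_).symm
    filter_upwards [hderiv] with t ht htm
    have hat : a < t := htm.1
    have hbt : b < t := by
      by_contra hcon
      exact htm.2 ⟨hat, not_lt.1 hcon⟩
    have h0 : HasDerivAt f 0 t := by
      refine (hasDerivAt_const t (0 : ℝ)).congr_of_eventuallyEq ?_
      filter_upwards [Ioi_mem_nhds hbt] with s hs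
      exact hzero s ((le_max_left _ _).trans (le_of_lt hs))
    exact (ht hat).unique h0
  have h2 : ∫ t in a..b, deriv f t = ∫ t in Ioc a b, f' t := by
    rw [intervalIntegral.integral_of_le hab]
    refine setIntegral_congr_ae measurableSet_Ioc ?_
    filter_upwards [hderiv] with t ht hm
    exact (ht hm.1).deriv
  rw [← h1, ← h2, (hac b hab).integral_deriv_eq_sub, hzero b (le_max_left _ _), zero_sub]

theorem abs_exp_neg_sub_exp_neg_le {u v : ℝ} (hu : 0 ≤ u) (hv : 0 ≤ v) :
    |Real.exp (-u) - Real.exp (-v)| ≤ |u - v| := by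
  wlog h : u ≤ v generalizing u v
  · rw [abs_sub_comm, abs_sub_comm u]
    exact this hv hu (le_of_not_ge h)
  have h1 : Real.exp (-v) = Real.exp (-u) * Real.exp (-(v - u)) := by
    rw [← Real.exp_add]; ring_nf
  have h2 : 1 - (v - u) ≤ Real.exp (-(v - u)) := by
    linarith [Real.add_one_le_exp (-(v - u))]
  have h3 : Real.exp (-u) ≤ 1 := Real.exp_le_one_iff.2 (by linarith)
  have h4 : Real.exp (-(v - u)) ≤ 1 := Real.exp_le_one_iff.2 (by linarith)
  have h5 := Real.exp_pos (-u)
  rw [abs_of_nonneg (by rw [h1]; nlinarith), abs_of_nonpos (by linarith), h1]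
  nlinarith

/-! ### The solution along characteristics -/

/-- The data which determine the density along characteristics: a nonnegative initial density `b`
on `(0, ∞)` and an activity `I` with values in `[0, rM]`. -/
structure IsInput (rM : ℝ) (b I : ℝ → ℝ) : Prop where
  measurable_initial : Measurable b
  initial_nonneg : ∀ y, 0 ≤ b y
  integrableOn_initial : IntegrableOn b (Ioi 0)
  measurable_activity : Measurable I
  activity_mem : ∀ t, I t ∈ Icc 0 rM

/-- The fraction of the neurons on the characteristic `x = y + t` that have not discharged up to
time `t`. No neuron with nonpositive age discharges, so neurons with `y < 0` effectively start at
time `-y`. -/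
noncomputable def survival (ρ : ℝ → ℝ → ℝ) (I : ℝ → ℝ) (t y : ℝ) : ℝ :=
  Real.exp (-∫ s in (0 : ℝ)..t, ρ (y + s) (I s))

/-- The density of neurons entering on the characteristic `x = y + t`: initially if `y > 0`, at
age zero and time `-y` if `y ≤ 0`. -/
noncomputable def source (b I : ℝ → ℝ) (y : ℝ) : ℝ := if 0 < y then b y else I (-y)

/-- The density at time `t` in the coordinate `y = x - t`, which is constant along
characteristics. -/
noncomputable def charDensity (ρ : ℝ → ℝ → ℝ) (b I : ℝ → ℝ) (t y : ℝ) : ℝ :=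
  (Ioi (-t)).indicator (fun y => source b I y * survival ρ I t y) y

section Survival

variable {I : ℝ → ℝ}

theorem IsRegularRate.measurable_hazard (hρ : IsRegularRate ρ rM L) (hI : Measurable I) :
    Measurable fun p : ℝ × ℝ => ρ (p.2 + p.1) (I p.1) :=
  hρ.measurable.comp ((measurable_snd.add measurable_fst).prodMk (hI.comp measurable_fst))

theorem IsRegularRate.measurable_hazard_left (hρ : IsRegularRate ρ rM L) (hI : Measurable I)
    (y : ℝ) : Measurable fun s => ρ (y + s) (I s) :=
  (hρ.measurable_hazard hI).comp (measurable_id.prodMk measurable_const)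

theorem IsRegularRate.locallyIntegrable_hazard (hρ : IsRegularRate ρ rM L) (hI : Measurable I)
    (y : ℝ) : LocallyIntegrable fun s => ρ (y + s) (I s) := by
  refine (locallyIntegrable_const rM).mono
    (hρ.measurable_hazard_left hI y).aestronglyMeasurable (Eventually.of_forall fun s => ?_)
  rw [Real.norm_eq_abs, Real.norm_eq_abs, abs_of_nonneg hρ.rM_nonneg]
  exact hρ.abs_le _ _

theorem IsRegularRate.intervalIntegrable_hazard (hρ : IsRegularRate ρ rM L) (hI : Measurable I)
    (y a b : ℝ) : IntervalIntegrable (fun s => ρ (y + s) (I s)) volume a b :=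
  ((hρ.locallyIntegrable_hazard hI y).integrableOn_isCompact isCompact_uIcc).intervalIntegrable

theorem IsRegularRate.integral_hazard_nonneg (hρ : IsRegularRate ρ rM L) {t : ℝ} (ht : 0 ≤ t)
    (y : ℝ) : 0 ≤ ∫ s in (0 : ℝ)..t, ρ (y + s) (I s) :=
  intervalIntegral.integral_nonneg ht fun _ _ => hρ.nonneg _ _

theorem survival_pos (t y : ℝ) : 0 < survival ρ I t y := Real.exp_pos _

theorem survival_le_one (hρ : IsRegularRate ρ rM L) {t : ℝ} (ht : 0 ≤ t) (y : ℝ) :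
    survival ρ I t y ≤ 1 :=
  Real.exp_le_one_iff.2 (neg_nonpos.2 (hρ.integral_hazard_nonneg ht y))

theorem survival_zero (y : ℝ) : survival ρ I 0 y = 1 := by simp [survival]

theorem survival_eq_one (hρ : IsRegularRate ρ rM L) {t y : ℝ} (ht : 0 ≤ t) (hty : t ≤ -y) :
    survival ρ I t y = 1 := by
  have : ∫ s in (0 : ℝ)..t, ρ (y + s) (I s) = 0 := by
    refine intervalIntegral.integral_zero_ae (Eventually.of_forall fun s hs => ?_)
    rw [uIoc_of_le ht] at hs
    exact hρ.eq_zero _ (by linarith [hs.2]) _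
  simp [survival, this]

theorem abs_survival_sub_le (hρ : IsRegularRate ρ rM L) (hI : Measurable I) {t s : ℝ}
    (ht : 0 ≤ t) (hs : 0 ≤ s) (y : ℝ) :
    |survival ρ I t y - survival ρ I s y| ≤ rM * |t - s| := by
  refine (abs_exp_neg_sub_exp_neg_le (hρ.integral_hazard_nonneg ht y)
    (hρ.integral_hazard_nonneg hs y)).trans ?_
  rw [intervalIntegral.integral_interval_sub_left (hρ.intervalIntegrable_hazard hI y _ _)
    (hρ.intervalIntegrable_hazard hI y _ _), ← Real.norm_eq_abs]
  exact intervalIntegral.norm_integral_le_of_norm_le_const fun _ _ => hρ.abs_le _ _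

theorem absolutelyContinuousOnInterval_survival (hρ : IsRegularRate ρ rM L) (hI : Measurable I)
    {a b : ℝ} (ha : 0 ≤ a) (hb : 0 ≤ b) (y : ℝ) :
    AbsolutelyContinuousOnInterval (fun t => survival ρ I t y) a b := by
  have hsub : ∀ t ∈ uIcc a b, 0 ≤ t := fun t ht => (le_min ha hb).trans ht.1
  refine LipschitzOnWith.absolutelyContinuousOnInterval (K := rM.toNNReal)
    (LipschitzOnWith.of_dist_le_mul fun t ht s hs => ?_)
  rw [Real.coe_toNNReal _ hρ.rM_nonneg]
  exact abs_survival_sub_le hρ hI (hsub t ht) (hsub s hs) y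

theorem continuous_survival (hρ : IsRegularRate ρ rM L) (hI : Measurable I) (y : ℝ) :
    Continuous fun t => survival ρ I t y :=
  Real.continuous_exp.comp (intervalIntegral.continuous_primitive
    (fun a b => hρ.intervalIntegrable_hazard hI y a b) 0).neg

theorem ae_hasDerivAt_survival (hρ : IsRegularRate ρ rM L) (hI : Measurable I) (y : ℝ) :
    ∀ᵐ t, HasDerivAt (fun t => survival ρ I t y) (-(ρ (y + t) (I t)) * survival ρ I t y) t := by
  filter_upwards [LocallyIntegrable.ae_hasDerivAt_integral
    (hρ.locallyIntegrable_hazard hI y)] with t ht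
  have := (ht 0).neg.exp
  rw [mul_comm]
  exact this

theorem measurable_survival (hρ : IsRegularRate ρ rM L) (hI : Measurable I) :
    Measurable fun p : ℝ × ℝ => survival ρ I p.1 p.2 := by
  refine measurable_uncurry_of_continuous_of_measurable
    (fun y => continuous_survival hρ hI y) fun t => ?_
  have hm : StronglyMeasurable (Function.uncurry fun (y s : ℝ) => ρ (y + s) (I s)) :=
    ((hρ.measurable_hazard hI).comp measurable_swap).stronglyMeasurable
  unfold survival intervalIntegral
  exact ((hm.integral_prod_right (ν := volume.restrict (Ioc 0 t))).sub
    (hm.integral_prod_right (ν := volume.restrict (Ioc t 0)))).measurable.neg.exp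

/-- The surviving fraction decreases by what is discharged. -/
theorem survival_eq_one_sub (hρ : IsRegularRate ρ rM L) (hI : Measurable I) {t : ℝ} (ht : 0 ≤ t)
    (y : ℝ) :
    survival ρ I t y = 1 - ∫ s in (0 : ℝ)..t, ρ (y + s) (I s) * survival ρ I s y := by
  have h := (absolutelyContinuousOnInterval_survival hρ hI le_rfl ht y).integral_deriv_eq_sub
  rw [survival_zero] at h
  have h2 : ∫ s in (0 : ℝ)..t, deriv (fun t => survival ρ I t y) s =
      ∫ s in (0 : ℝ)..t, -(ρ (y + s) (I s) * survival ρ I s y) := by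
    refine intervalIntegral.integral_congr_ae ?_
    filter_upwards [ae_hasDerivAt_survival hρ hI y] with s hs _
    rw [hs.deriv, neg_mul]
  rw [h2, intervalIntegral.integral_neg] at h
  linarith

theorem abs_survival_sub_survival_le (hρ : IsRegularRate ρ rM L) {J : ℝ → ℝ} (hI : Measurable I)
    (hJ : Measurable J) {t : ℝ} (ht : 0 ≤ t)
    (hint : IntervalIntegrable (fun s => |I s - J s|) volume 0 t) (y : ℝ) :
    |survival ρ I t y - survival ρ J t y| ≤ L * ∫ s in (0 : ℝ)..t, |I s - J s| := by
  refine (abs_exp_neg_sub_exp_neg_le (hρ.integral_hazard_nonneg ht y)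
    (hρ.integral_hazard_nonneg ht y)).trans ?_
  rw [← intervalIntegral.integral_sub (hρ.intervalIntegrable_hazard hI y _ _)
    (hρ.intervalIntegrable_hazard hJ y _ _), ← intervalIntegral.integral_const_mul,
    ← Real.norm_eq_abs]
  exact intervalIntegral.norm_integral_le_of_norm_le ht
    (Eventually.of_forall fun s _ => hρ.lipschitz _ _ _) (hint.const_mul L)

end Survival

section Density

variable {b I : ℝ → ℝ}

theorem IsInput.abs_activity_le (h : IsInput rM b I) (t : ℝ) : |I t| ≤ rM := by
  rw [abs_of_nonneg (h.activity_mem t).1]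
  exact (h.activity_mem t).2

theorem IsInput.intervalIntegrable_activity (h : IsInput rM b I) (a c : ℝ) :
    IntervalIntegrable I volume a c := by
  refine (intervalIntegrable_const (c := rM)).mono_fun
    h.measurable_activity.aestronglyMeasurable (Eventually.of_forall fun s => ?_)
  exact (h.abs_activity_le s).trans (le_abs_self _)

theorem IsInput.measurable_source (h : IsInput rM b I) : Measurable (source b I) :=
  h.measurable_initial.ite measurableSet_Ioi (h.measurable_activity.comp measurable_neg)

theorem IsInput.source_nonneg (h : IsInput rM b I) (y : ℝ) : 0 ≤ source b I y := by
  unfold source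
  split_ifs
  · exact h.initial_nonneg y
  · exact (h.activity_mem _).1

theorem IsInput.integrableOn_source_Ioc (h : IsInput rM b I) {t : ℝ} (ht : 0 ≤ t) :
    IntegrableOn (source b I) (Ioc (-t) 0) := by
  have h1 : IntervalIntegrable (fun y => I (-y)) volume (-t) 0 := by
    simpa using (h.intervalIntegrable_activity t 0).comp_sub_left 0
  rw [intervalIntegrable_iff_integrableOn_Ioc_of_le (neg_nonpos.2 ht)] at h1
  exact h1.congr_fun (fun y hy => by simp [source, not_lt.2 hy.2]) measurableSet_Ioc

theorem IsInput.integrableOn_source_Ioi_zero (h : IsInput rM b I) :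
    IntegrableOn (source b I) (Ioi 0) :=
  h.integrableOn_initial.congr_fun (fun y hy => by simp [source, mem_Ioi.1 hy]) measurableSet_Ioi

theorem IsInput.integrableOn_source (h : IsInput rM b I) (t : ℝ) :
    IntegrableOn (source b I) (Ioi (-t)) := by
  rcases le_total 0 t with ht | ht
  · rw [← Ioc_union_Ioi_eq_Ioi (neg_nonpos.2 ht)]
    exact (h.integrableOn_source_Ioc ht).union h.integrableOn_source_Ioi_zero
  · exact h.integrableOn_source_Ioi_zero.mono_set (Ioi_subset_Ioi (by linarith))

theorem IsInput.integral_source (h : IsInput rM b I) {t : ℝ} (ht : 0 ≤ t) :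
    ∫ y in Ioi (-t), source b I y = (∫ y in Ioi 0, b y) + ∫ s in (0 : ℝ)..t, I s := by
  rw [← Ioc_union_Ioi_eq_Ioi (neg_nonpos.2 ht), setIntegral_union (Ioc_disjoint_Ioi le_rfl)
    measurableSet_Ioi (h.integrableOn_source_Ioc ht) h.integrableOn_source_Ioi_zero, add_comm]
  congr 1
  · exact setIntegral_congr_fun measurableSet_Ioi fun y hy => by simp [source, mem_Ioi.1 hy]
  · have h1 : ∫ y in Ioc (-t) 0, source b I y = ∫ y in Ioc (-t) 0, I (-y) :=
      setIntegral_congr_fun measurableSet_Ioc fun y hy => by simp [source, not_lt.2 hy.2]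
    rw [h1, ← intervalIntegral.integral_of_le (neg_nonpos.2 ht),
      intervalIntegral.integral_comp_neg]
    simp

theorem charDensity_of_le {t y : ℝ} (h : y ≤ -t) : charDensity ρ b I t y = 0 :=
  indicator_of_notMem (not_lt.2 h) _

theorem charDensity_of_lt {t y : ℝ} (h : -t < y) :
    charDensity ρ b I t y = source b I y * survival ρ I t y :=
  indicator_of_mem (mem_Ioi.2 h) _

theorem charDensity_nonneg (h : IsInput rM b I) (t y : ℝ) : 0 ≤ charDensity ρ b I t y :=
  indicator_nonneg (fun y _ => mul_nonneg (h.source_nonneg y) (survival_pos t y).le) y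

theorem measurable_charDensity (hρ : IsRegularRate ρ rM L) (h : IsInput rM b I) :
    Measurable fun p : ℝ × ℝ => charDensity ρ b I p.1 p.2 := by
  have hs : MeasurableSet {p : ℝ × ℝ | -p.1 < p.2} :=
    measurableSet_lt measurable_fst.neg measurable_snd
  have := ((h.measurable_source.comp measurable_snd).mul
    (measurable_survival hρ h.measurable_activity)).indicator hs
  convert! this using 1

theorem charDensity_le (hρ : IsRegularRate ρ rM L) (h : IsInput rM b I) {t T : ℝ} (ht : 0 ≤ t)
    (htT : t ≤ T) (y : ℝ) :
    charDensity ρ b I t y ≤ (Ioi (-T)).indicator (source b I) y := by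
  by_cases hy : -t < y
  · rw [charDensity_of_lt hy, indicator_of_mem (mem_Ioi.2 (by linarith))]
    exact mul_le_of_le_one_right (h.source_nonneg y) (survival_le_one hρ ht y)
  · rw [charDensity_of_le (not_lt.1 hy)]
    exact indicator_nonneg (fun y _ => h.source_nonneg y) y

theorem integrable_indicator_source (h : IsInput rM b I) (t : ℝ) :
    Integrable ((Ioi (-t)).indicator (source b I)) :=
  (h.integrableOn_source t).integrable_indicator measurableSet_Ioi

theorem integrable_charDensity (hρ : IsRegularRate ρ rM L) (h : IsInput rM b I) {t : ℝ}
    (ht : 0 ≤ t) : Integrable (charDensity ρ b I t) := by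
  refine (integrable_indicator_source h t).mono'
    ((measurable_charDensity hρ h).comp
      (measurable_const.prodMk measurable_id)).aestronglyMeasurable
    (Eventually.of_forall fun y => ?_)
  rw [Real.norm_of_nonneg (charDensity_nonneg h t y)]
  exact charDensity_le hρ h ht le_rfl y

theorem tendsto_integral_abs_charDensity_sub (hρ : IsRegularRate ρ rM L) (h : IsInput rM b I)
    (t₀ : ℝ≥0) :
    Tendsto (fun t : ℝ≥0 => ∫ y, |charDensity ρ b I t y - charDensity ρ b I t₀ y|) (𝓝 t₀)
      (𝓝 0) := by
  have hm : ∀ t, Measurable (charDensity ρ b I t) := fun t =>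
    (measurable_charDensity hρ h).comp (measurable_const.prodMk measurable_id)
  rw [← integral_zero ℝ ℝ]
  refine tendsto_integral_filter_of_dominated_convergence
    (fun y => 2 * (Ioi (-((t₀ : ℝ) + 1))).indicator (source b I) y)
    (Eventually.of_forall fun t => ((hm t).sub (hm t₀)).norm.aestronglyMeasurable) ?_
    ((integrable_indicator_source h _).const_mul 2) ?_
  · have : ∀ᶠ t : ℝ≥0 in 𝓝 t₀, t < t₀ + 1 := eventually_lt_nhds (by simp)
    filter_upwards [this] with t ht
    refine Eventually.of_forall fun y => ?_
    have ht' : (t : ℝ) ≤ t₀ + 1 := by exact_mod_cast ht.le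
    have h1 := charDensity_le hρ h t.2 ht' y
    have h2 := charDensity_le hρ h t₀.2 (show (t₀ : ℝ) ≤ t₀ + 1 by linarith) y
    have h3 := charDensity_nonneg (ρ := ρ) h t y
    have h4 := charDensity_nonneg (ρ := ρ) h t₀ y
    rw [Real.norm_eq_abs, abs_abs, abs_le]
    constructor <;> simp only [NNReal.val_eq_coe] at * <;> linarith
  · have hne : ∀ᵐ y : ℝ, y ≠ -t₀ := by simp [ae_iff, measure_singleton]
    filter_upwards [hne] with y hy
    have hcoe : Tendsto (fun t : ℝ≥0 => (t : ℝ)) (𝓝 t₀) (𝓝 t₀) :=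
      NNReal.continuous_coe.tendsto t₀
    have key : Tendsto (fun t : ℝ≥0 => charDensity ρ b I t y) (𝓝 t₀)
        (𝓝 (charDensity ρ b I t₀ y)) := by
      rcases lt_or_gt_of_ne hy with hlt | hgt
      · rw [charDensity_of_le hlt.le]
        refine tendsto_const_nhds.congr' ?_
        have : ∀ᶠ t : ℝ≥0 in 𝓝 t₀, (t : ℝ) < -y := hcoe.eventually_lt_const (by linarith)
        filter_upwards [this] with t ht
        rw [charDensity_of_le (by linarith)]
      · rw [charDensity_of_lt hgt]
        have h1 : Tendsto (fun t : ℝ≥0 => source b I y * survival ρ I t y) (𝓝 t₀)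
            (𝓝 (source b I y * survival ρ I t₀ y)) :=
          (((continuous_survival hρ h.measurable_activity y).tendsto _).comp hcoe).const_mul _
        refine h1.congr' ?_
        have : ∀ᶠ t : ℝ≥0 in 𝓝 t₀, -y < (t : ℝ) := hcoe.eventually_const_lt (by linarith)
        filter_upwards [this] with t ht
        rw [charDensity_of_lt (by linarith)]
    have := (key.sub_const (charDensity ρ b I t₀ y)).abs
    simpa using this

theorem integrable_discharged (hρ : IsRegularRate ρ rM L) (h : IsInput rM b I) (t : ℝ) :
    Integrable (Function.uncurry fun (s y : ℝ) => ρ (y + s) (I s) * charDensity ρ b I s y)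
      ((volume.restrict (Ioc 0 t)).prod volume) := by
  have hI := h.measurable_activity
  have hmeas : Measurable fun p : ℝ × ℝ => ρ (p.2 + p.1) (I p.1) * charDensity ρ b I p.1 p.2 :=
    (hρ.measurable_hazard hI).mul (measurable_charDensity hρ h)
  have hbound : ∀ s ∈ Ioc 0 t, ∀ y, ‖ρ (y + s) (I s) * charDensity ρ b I s y‖ ≤
      rM * (Ioi (-t)).indicator (source b I) y := by
    intro s hs y
    rw [norm_mul, Real.norm_of_nonneg (charDensity_nonneg h s y)]
    exact mul_le_mul (hρ.abs_le _ _) (charDensity_le hρ h hs.1.le hs.2 y)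
      (charDensity_nonneg h s y) hρ.rM_nonneg
  have hdom : Integrable (fun p : ℝ × ℝ => (1 : ℝ) * (rM * (Ioi (-t)).indicator (source b I) p.2))
      ((volume.restrict (Ioc 0 t)).prod volume) :=
    Integrable.mul_prod (integrable_const 1) ((integrable_indicator_source h t).const_mul rM)
  refine hdom.mono' hmeas.aestronglyMeasurable ?_
  have : ∀ᵐ p : ℝ × ℝ ∂((volume.restrict (Ioc 0 t)).prod volume), p.1 ∈ Ioc 0 t :=
    Measure.quasiMeasurePreserving_fst.ae (ae_restrict_mem measurableSet_Ioc)
  filter_upwards [this] with p hp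
  rw [one_mul]
  exact hbound p.1 hp p.2

/-- Mass balance: the mass of the density grows by what is born and decreases by what is
discharged. -/
theorem integral_charDensity (hρ : IsRegularRate ρ rM L) (h : IsInput rM b I) {t : ℝ}
    (ht : 0 ≤ t) :
    ∫ y, charDensity ρ b I t y = (∫ y in Ioi 0, b y) + (∫ s in (0 : ℝ)..t, I s)
      - ∫ s in (0 : ℝ)..t, ∫ y, ρ (y + s) (I s) * charDensity ρ b I s y := by
  have hI := h.measurable_activity
  have hint := integrable_discharged hρ h t
  -- integrate `survival_eq_one_sub`, times the source, over `y > -t`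
  have hswap : ∫ s in (0 : ℝ)..t, ∫ y, ρ (y + s) (I s) * charDensity ρ b I s y =
      ∫ y, ∫ s in (0 : ℝ)..t, ρ (y + s) (I s) * charDensity ρ b I s y := by
    simp_rw [intervalIntegral.integral_of_le ht]
    exact integral_integral_swap hint
  have hint2 : Integrable fun y => ∫ s in (0 : ℝ)..t, ρ (y + s) (I s) * charDensity ρ b I s y := by
    simp_rw [intervalIntegral.integral_of_le ht]
    exact hint.integral_prod_right
  rw [hswap, ← h.integral_source ht, ← integral_indicator measurableSet_Ioi,
    ← integral_sub (integrable_indicator_source h t) hint2]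
  refine integral_congr_ae (Eventually.of_forall fun y => ?_)
  by_cases hy : -t < y
  · have h1 : ∫ s in (0 : ℝ)..t, ρ (y + s) (I s) * charDensity ρ b I s y =
        ∫ s in (0 : ℝ)..t, source b I y * (ρ (y + s) (I s) * survival ρ I s y) := by
      refine intervalIntegral.integral_congr fun s _ => ?_
      -- at times `s ≤ -y` the age `y + s` is not positive, so that the rate vanishes
      by_cases hs : -s < y
      · simp only [charDensity_of_lt hs]
        ring
      · simp only [hρ.eq_zero (y + s) (by linarith)]
        ring
    simp only [charDensity_of_lt hy, indicator_of_mem (mem_Ioi.2 hy)]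
    rw [h1, intervalIntegral.integral_const_mul, survival_eq_one_sub hρ hI ht]
    ring
  · have h1 : ∫ s in (0 : ℝ)..t, ρ (y + s) (I s) * charDensity ρ b I s y = 0 := by
      refine intervalIntegral.integral_zero_ae (Eventually.of_forall fun s hs => ?_)
      rw [uIoc_of_le ht] at hs
      rw [charDensity_of_le (by linarith [hs.2]), mul_zero]
    simp only [charDensity_of_le (not_lt.1 hy), indicator_of_notMem (s := Ioi (-t)) hy, h1,
      sub_zero]

theorem integral_abs_charDensity_sub_le {J : ℝ → ℝ} (hρ : IsRegularRate ρ rM L)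
    (h : IsInput rM b I) (hJ : IsInput rM b J) {t : ℝ} (ht : 0 ≤ t) :
    ∫ y, |charDensity ρ b I t y - charDensity ρ b J t y| ≤
      (1 + L * ((∫ y in Ioi 0, b y) + rM * t)) * ∫ s in (0 : ℝ)..t, |I s - J s| := by
  have hintIJ : IntervalIntegrable (fun s => |I s - J s|) volume 0 t :=
    ((h.intervalIntegrable_activity 0 t).sub (hJ.intervalIntegrable_activity 0 t)).abs
  have hIJ0 : 0 ≤ ∫ s in (0 : ℝ)..t, |I s - J s| :=
    intervalIntegral.integral_nonneg ht fun _ _ => abs_nonneg _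
  have hneg : IntegrableOn (fun y => |I (-y) - J (-y)|) (Ioc (-t) 0) := by
    rw [← intervalIntegrable_iff_integrableOn_Ioc_of_le (neg_nonpos.2 ht)]
    simpa using hintIJ.symm.comp_sub_left 0
  have hnegval : ∫ y in Ioc (-t) 0, |I (-y) - J (-y)| = ∫ s in (0 : ℝ)..t, |I s - J s| := by
    rw [← intervalIntegral.integral_of_le (neg_nonpos.2 ht),
      intervalIntegral.integral_comp_neg (fun s => |I s - J s|)]
    simp
  set K := ∫ s in (0 : ℝ)..t, |I s - J s| with hK
  have hL : 0 ≤ L * K := by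
    refine le_trans ?_ (abs_survival_sub_survival_le hρ h.measurable_activity
      hJ.measurable_activity ht hintIJ 0)
    positivity
  have hpt : ∀ y, |charDensity ρ b I t y - charDensity ρ b J t y| ≤
      (Ioc (-t) 0).indicator (fun y => |I (-y) - J (-y)|) y +
        L * K * (Ioi (-t)).indicator (source b J) y := by
    intro y
    by_cases hy : -t < y
    · rw [charDensity_of_lt hy, charDensity_of_lt hy, indicator_of_mem (mem_Ioi.2 hy)]
      have h1 : |source b I y - source b J y| ≤
          (Ioc (-t) 0).indicator (fun y => |I (-y) - J (-y)|) y := by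
        by_cases hy0 : 0 < y
        · rw [indicator_of_notMem (fun hm => absurd hm.2 (not_le.2 hy0))]
          simp [source, hy0]
        · rw [indicator_of_mem (s := Ioc (-t) 0) ⟨hy, not_lt.1 hy0⟩]
          simp [source, hy0]
      have h2 := abs_survival_sub_survival_le hρ h.measurable_activity
        hJ.measurable_activity ht hintIJ y
      have h3 := survival_le_one (I := I) hρ ht y
      calc |source b I y * survival ρ I t y - source b J y * survival ρ J t y|
          = |(source b I y - source b J y) * survival ρ I t y
              + source b J y * (survival ρ I t y - survival ρ J t y)| := by ring_nf
        _ ≤ |source b I y - source b J y| * survival ρ I t y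
              + source b J y * |survival ρ I t y - survival ρ J t y| := by
            refine (abs_add_le _ _).trans ?_
            rw [abs_mul, abs_mul, abs_of_pos (survival_pos t y),
              abs_of_nonneg (hJ.source_nonneg y)]
        _ ≤ |source b I y - source b J y| * 1 + source b J y * (L * K) :=
            add_le_add (mul_le_mul_of_nonneg_left h3 (abs_nonneg _))
              (mul_le_mul_of_nonneg_left h2 (hJ.source_nonneg y))
        _ ≤ _ := by
            rw [mul_one, mul_comm (source b J y)]
            gcongr
    · rw [charDensity_of_le (not_lt.1 hy), charDensity_of_le (not_lt.1 hy), sub_self, abs_zero]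
      exact add_nonneg (indicator_nonneg (fun _ _ => abs_nonneg _) _)
        (mul_nonneg hL (indicator_nonneg (fun y _ => hJ.source_nonneg y) _))
  have hi1 := hneg.integrable_indicator measurableSet_Ioc
  have hi2 := (integrable_indicator_source hJ t).const_mul (L * K)
  calc ∫ y, |charDensity ρ b I t y - charDensity ρ b J t y|
      ≤ ∫ y, ((Ioc (-t) 0).indicator (fun y => |I (-y) - J (-y)|) y +
        L * K * (Ioi (-t)).indicator (source b J) y) :=
        integral_mono ((integrable_charDensity hρ h ht).sub
          (integrable_charDensity hρ hJ ht)).abs (hi1.add hi2) hpt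
    _ = K + L * K * ((∫ y in Ioi 0, b y) + ∫ s in (0 : ℝ)..t, J s) := by
        rw [integral_add hi1 hi2, integral_const_mul, integral_indicator measurableSet_Ioc,
          integral_indicator measurableSet_Ioi, hnegval, hJ.integral_source ht]
    _ ≤ K + L * K * ((∫ y in Ioi 0, b y) + rM * t) := by
        have : ∫ s in (0 : ℝ)..t, J s ≤ ∫ s in (0 : ℝ)..t, rM :=
          intervalIntegral.integral_mono_on ht (hJ.intervalIntegrable_activity 0 t)
            (by simp) fun s _ => (hJ.activity_mem s).2
        rw [intervalIntegral.integral_const, smul_eq_mul, sub_zero, mul_comm] at this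
        gcongr
    _ = _ := by ring

end Density

/-! ### From characteristics to ages -/

/-- The density in the age variable `x > 0` at time `t` of a density `f` given in the coordinate
`y = x - t`. -/
noncomputable def toAge (f : ℝ → ℝ) (hf : Integrable f) (t : ℝ) : L1Age :=
  ((hf.comp_sub_right t).integrableOn (s := Ioi 0)).toL1 fun x => f (x - t)

theorem coeFn_toAge {f : ℝ → ℝ} (hf : Integrable f) (t : ℝ) :
    toAge f hf t =ᵐ[ageMeasure] fun x => f (x - t) :=
  Integrable.coeFn_toL1 _

theorem integral_mul_toAge {f : ℝ → ℝ} (hf : Integrable f) {t : ℝ} (h0 : ∀ y ≤ -t, f y = 0)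
    (w : ℝ → ℝ) :
    ∫ x in Ioi (0 : ℝ), w x * toAge f hf t x = ∫ y, w (y + t) * f y := by
  have h1 : ∫ x in Ioi (0 : ℝ), w x * toAge f hf t x = ∫ x in Ioi (0 : ℝ), w x * f (x - t) := by
    refine integral_congr_ae ?_
    filter_upwards [coeFn_toAge hf t] with x hx
    rw [hx]
  rw [h1, setIntegral_eq_integral_of_forall_compl_eq_zero fun x hx => ?_,
    ← integral_sub_right_eq_self (fun y => w (y + t) * f y) t]
  · simp only [sub_add_cancel]
  · rw [h0 _ (by linarith [notMem_Ioi.1 hx]), mul_zero]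

theorem norm_toAge_sub_le {f g : ℝ → ℝ} (hf : Integrable f) (hg : Integrable g) (t : ℝ) :
    ‖toAge f hf t - toAge g hg t‖ ≤ ∫ y, |f y - g y| := by
  have hi := ((hf.sub hg).comp_sub_right t).norm
  rw [L1.norm_eq_integral_norm, ← integral_sub_right_eq_self (fun y => |f y - g y|) t]
  refine le_trans (le_of_eq (integral_congr_ae ?_)) (setIntegral_le_integral (s := Ioi 0) hi
    (Eventually.of_forall fun x => abs_nonneg _))
  filter_upwards [Lp.coeFn_sub (toAge f hf t) (toAge g hg t), coeFn_toAge hf t,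
    coeFn_toAge hg t] with x h1 h2 h3
  rw [h1, Pi.sub_apply, h2, h3, Real.norm_eq_abs]

theorem norm_toAge_le {f : ℝ → ℝ} (hf : Integrable f) (t : ℝ) :
    ‖toAge f hf t‖ ≤ ∫ y, |f y| := by
  have hi := (hf.comp_sub_right t).norm
  rw [L1.norm_eq_integral_norm, ← integral_sub_right_eq_self (fun y => |f y|) t]
  refine le_trans (le_of_eq (integral_congr_ae ?_)) (setIntegral_le_integral (s := Ioi 0) hi
    (Eventually.of_forall fun x => abs_nonneg _))
  filter_upwards [coeFn_toAge hf t] with x h1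
  rw [h1, Real.norm_eq_abs]

/-- Continuity of translations in `L¹`. -/
theorem continuous_toAge {f : ℝ≥0 → ℝ → ℝ} (hf : ∀ t, Integrable (f t))
    (hcont : ∀ t₀, Tendsto (fun t => ∫ y, |f t y - f t₀ y|) (𝓝 t₀) (𝓝 0)) :
    Continuous fun t : ℝ≥0 => toAge (f t) (hf t) t := by
  have h1 : Continuous fun t => (hf t).toL1 (f t) := by
    refine continuous_iff_continuousAt.2 fun t₀ => tendsto_iff_norm_sub_tendsto_zero.2 ?_
    refine (hcont t₀).congr fun t => ?_
    rw [← Integrable.toL1_sub, L1.norm_eq_integral_norm]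
    refine integral_congr_ae ?_
    filter_upwards [Integrable.coeFn_toL1 ((hf t).sub (hf t₀))] with y hy
    rw [hy]
    rfl
  let g : ℝ≥0 → C(ℝ, ℝ) := fun t => ⟨fun x => x - t, by fun_prop⟩
  have hg : Continuous g := ContinuousMap.continuous_of_continuous_uncurry _ (by
    change Continuous fun p : ℝ≥0 × ℝ => p.2 - (p.1 : ℝ)
    fun_prop)
  have hgm : ∀ t, MeasurePreserving (g t) volume volume := fun t =>
    measurePreserving_sub_right volume (t : ℝ)
  have h2 := (LpToLpRestrictCLM ℝ ℝ ℝ volume 1 (Ioi 0)).continuous.comp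
    (h1.compMeasurePreservingLp hg hgm ENNReal.one_ne_top)
  convert! h2 using 2 with t
  refine Lp.ext ((coeFn_toAge (hf t) t).trans ?_)
  refine EventuallyEq.trans ?_ (LpToLpRestrictCLM_coeFn ℝ (Ioi 0) _).symm
  refine ae_restrict_of_ae ?_
  have h3 := Lp.coeFn_compMeasurePreserving ((hf t).toL1 (f t)) (hgm t)
  have h4 := (hgm t).quasiMeasurePreserving.ae_eq_comp (Integrable.coeFn_toL1 (hf t))
  filter_upwards [h3, h4] with x hx hx'
  rw [hx, hx']
  rfl

/-! ### The weak formulation along characteristics -/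

theorem hasDerivAt_comp_characteristic {φ : ℝ × ℝ → ℝ} (hφ : Differentiable ℝ φ) (y t : ℝ) :
    HasDerivAt (fun s => φ (s, y + s)) (fderiv ℝ φ (t, y + t) (1, 1)) t :=
  (hφ (t, y + t)).hasFDerivAt.comp_hasDerivAt t
    ((hasDerivAt_id t).prodMk ((hasDerivAt_id t).const_add y))

theorem exists_radius_of_hasCompactSupport {φ : ℝ × ℝ → ℝ} (hc : HasCompactSupport φ) :
    ∃ R : ℝ, 0 < R ∧ ∀ t x, R ≤ |t| ∨ R ≤ |x| →
      φ (t, x) = 0 ∧ fderiv ℝ φ (t, x) = 0 := by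
  obtain ⟨R, hR0, hR⟩ := hc.isCompact.isBounded.subset_ball_lt 0 (0 : ℝ × ℝ)
  refine ⟨R, hR0, fun t x h => ?_⟩
  have hnot : (t, x) ∉ tsupport φ := by
    intro hm
    have h1 := hR hm
    rw [mem_ball_zero_iff, Prod.norm_def, max_lt_iff] at h1
    rcases h with h | h
    · exact absurd h1.1 (not_lt.2 h)
    · exact absurd h1.2 (not_lt.2 h)
  exact ⟨image_eq_zero_of_notMem_tsupport hnot,
    image_eq_zero_of_notMem_tsupport fun hm => hnot (tsupport_fderiv_subset ℝ hm)⟩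

section WeakFormulation

variable {b I : ℝ → ℝ}

/-- Integrating the equation along one characteristic leaves the value of the test function at the
point where the characteristic enters the quadrant `t, x ≥ 0`. -/
theorem integral_charDensity_mul_characteristic (hρ : IsRegularRate ρ rM L) (h : IsInput rM b I)
    {φ : ℝ × ℝ → ℝ} (hφ : ContDiff ℝ ∞ φ) (hc : HasCompactSupport φ) (y : ℝ) :
    ∫ t in Ioi (0 : ℝ), charDensity ρ b I t y *
        (fderiv ℝ φ (t, y + t) (1, 1) - ρ (y + t) (I t) * φ (t, y + t)) =
      -(source b I y * φ (max 0 (-y), y + max 0 (-y))) := by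
  have hI := h.measurable_activity
  set a := max 0 (-y) with ha
  have ha0 : 0 ≤ a := le_max_left _ _
  obtain ⟨R, hR0, hR⟩ := exists_radius_of_hasCompactSupport hc
  have h1 : ∫ t in Ioi (0 : ℝ), charDensity ρ b I t y *
        (fderiv ℝ φ (t, y + t) (1, 1) - ρ (y + t) (I t) * φ (t, y + t)) =
      ∫ t in Ioi a, charDensity ρ b I t y *
        (fderiv ℝ φ (t, y + t) (1, 1) - ρ (y + t) (I t) * φ (t, y + t)) := by
    refine setIntegral_eq_of_subset_of_forall_sdiff_eq_zero measurableSet_Ioi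
      (Ioi_subset_Ioi ha0) fun t ht => ?_
    have ht1 : t ≤ -y := by
      by_contra hcon
      exact ht.2 (max_lt ht.1 (not_le.1 hcon))
    rw [charDensity_of_le (by linarith), zero_mul]
  have h2 : ∫ t in Ioi a, charDensity ρ b I t y *
        (fderiv ℝ φ (t, y + t) (1, 1) - ρ (y + t) (I t) * φ (t, y + t)) =
      ∫ t in Ioi a, source b I y * (-(ρ (y + t) (I t)) * survival ρ I t y * φ (t, y + t) +
        survival ρ I t y * fderiv ℝ φ (t, y + t) (1, 1)) := by
    refine setIntegral_congr_fun measurableSet_Ioi fun t ht => ?_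
    have ht1 : -t < y := by
      have := (max_lt_iff.1 (mem_Ioi.1 ht)).2
      linarith
    simp only [charDensity_of_lt ht1]
    ring
  have hφ1 : Differentiable ℝ φ := hφ.differentiable (by simp)
  have hac : ∀ c, a ≤ c → AbsolutelyContinuousOnInterval
      (fun t => survival ρ I t y * φ (t, y + t)) a c := by
    intro c hac
    refine (absolutelyContinuousOnInterval_survival hρ hI ha0 (ha0.trans hac) y).fun_mul ?_
    have : ContDiff ℝ 1 fun t => φ (t, y + t) :=
      (hφ.of_le (by simp)).comp (contDiff_id.prodMk (contDiff_const.add contDiff_id))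
    exact this.contDiffOn.absolutelyContinuousOnInterval
  have h3 := integral_Ioi_of_ae_hasDerivAt_of_eq_zero (R := R) hac
    (by
      filter_upwards [ae_hasDerivAt_survival hρ hI y] with t ht _
      exact ht.mul (hasDerivAt_comp_characteristic hφ1 y t))
    (fun t ht => by
      rw [(hR t (y + t) (Or.inl (ht.trans (le_abs_self t)))).1, mul_zero])
  have h4 : survival ρ I a y = 1 := by
    rcases le_total 0 (-y) with hy | hy
    · exact survival_eq_one hρ ha0 (by rw [ha, max_eq_right hy])
    · rw [ha, max_eq_left hy, survival_zero]
  rw [h1, h2, integral_const_mul, h3, h4]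
  ring

theorem weakFormulation_charDensity (hρ : IsRegularRate ρ rM L) (h : IsInput rM b I)
    {φ : ℝ × ℝ → ℝ} (hφ : ContDiff ℝ ∞ φ) (hc : HasCompactSupport φ) :
    (∫ t in Ioi (0 : ℝ), ∫ y, charDensity ρ b I t y *
        (fderiv ℝ φ (t, y + t) (1, 1) - ρ (y + t) (I t) * φ (t, y + t)))
      + (∫ y in Ioi (0 : ℝ), b y * φ (0, y)) + (∫ t in Ioi (0 : ℝ), I t * φ (t, 0)) = 0 := by
  obtain ⟨R, hR0, hR⟩ := exists_radius_of_hasCompactSupport hc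
  obtain ⟨C, hC⟩ := hc.exists_bound_of_continuous hφ.continuous
  have hφ' : Continuous (fderiv ℝ φ) := hφ.continuous_fderiv (by simp)
  have hDcont : Continuous fun p : ℝ × ℝ => fderiv ℝ φ p (1, 1) := hφ'.clm_apply continuous_const
  obtain ⟨D, hD⟩ := (hc.fderiv (𝕜 := ℝ)).exists_bound_of_continuous hφ'
  have hC0 : 0 ≤ C := (norm_nonneg _).trans (hC 0)
  have hD0 : 0 ≤ D := (norm_nonneg _).trans (hD 0)
  set F : ℝ → ℝ → ℝ := fun t y => charDensity ρ b I t y *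
    (fderiv ℝ φ (t, y + t) (1, 1) - ρ (y + t) (I t) * φ (t, y + t)) with hF
  have hmeas : Measurable (Function.uncurry F) := by
    have hshear : Measurable fun p : ℝ × ℝ => (p.1, p.2 + p.1) := by fun_prop
    exact (measurable_charDensity hρ h).mul ((hDcont.measurable.comp hshear).sub
      ((hρ.measurable_hazard h.measurable_activity).mul (hφ.continuous.measurable.comp hshear)))
  have hbound : ∀ t, 0 < t → ∀ y, ‖F t y‖ ≤ (Ioc 0 R).indicator (fun _ => D + rM * C) t *
      (Ioi (-R)).indicator (source b I) y := by
    intro t ht y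
    by_cases htR : t ≤ R
    · rw [indicator_of_mem (s := Ioc 0 R) ⟨ht, htR⟩, hF, norm_mul,
        Real.norm_of_nonneg (charDensity_nonneg h t y), mul_comm]
      refine mul_le_mul ?_ (charDensity_le hρ h ht.le htR y) (charDensity_nonneg h t y)
        (add_nonneg hD0 (mul_nonneg hρ.rM_nonneg hC0))
      refine (norm_sub_le _ _).trans (add_le_add ?_ ?_)
      · refine ((fderiv ℝ φ (t, y + t)).le_opNorm _).trans ?_
        have : ‖((1 : ℝ), (1 : ℝ))‖ = 1 := by simp [Prod.norm_def]
        rw [this, mul_one]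
        exact hD _
      · rw [norm_mul]
        exact mul_le_mul (hρ.abs_le _ _) (hC _) (norm_nonneg _) hρ.rM_nonneg
    · obtain ⟨h1, h2⟩ := hR t (y + t) (Or.inl ((not_le.1 htR).le.trans (le_abs_self t)))
      rw [hF]
      simp only [h1, h2, zero_apply, mul_zero, sub_self, norm_zero]
      exact mul_nonneg (indicator_nonneg (fun _ _ =>
        add_nonneg hD0 (mul_nonneg hρ.rM_nonneg hC0)) _)
        (indicator_nonneg (fun y _ => h.source_nonneg y) y)
  have hint : Integrable (Function.uncurry F) ((volume.restrict (Ioi 0)).prod volume) := by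
    have h1 : Integrable ((Ioc 0 R).indicator fun _ => D + rM * C) (volume.restrict (Ioi 0)) :=
      Integrable.restrict (IntegrableOn.integrable_indicator (by simp) measurableSet_Ioc)
    refine (h1.mul_prod (integrable_indicator_source h R)).mono' hmeas.aestronglyMeasurable ?_
    have : ∀ᵐ p : ℝ × ℝ ∂((volume.restrict (Ioi 0)).prod volume), p.1 ∈ Ioi (0 : ℝ) :=
      Measure.quasiMeasurePreserving_fst.ae (ae_restrict_mem measurableSet_Ioi)
    filter_upwards [this] with p hp
    exact hbound p.1 hp p.2
  have hval : ∀ y, ∫ t in Ioi (0 : ℝ), F t y =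
      -(source b I y * φ (max 0 (-y), y + max 0 (-y))) :=
    integral_charDensity_mul_characteristic hρ h hφ hc
  have hvint : Integrable fun y => source b I y * φ (max 0 (-y), y + max 0 (-y)) := by
    have := hint.integral_prod_right.neg
    refine this.congr (Eventually.of_forall fun y => ?_)
    have hy := hval y
    simp only [Pi.neg_apply, Function.uncurry_apply_pair]
    rw [hy, neg_neg]
  rw [integral_integral_swap hint, integral_congr_ae (Eventually.of_forall hval), integral_neg,
    ← integral_add_compl (measurableSet_Ioi (a := (0 : ℝ))) hvint]
  have h1 : ∫ y in Ioi (0 : ℝ), source b I y * φ (max 0 (-y), y + max 0 (-y)) =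
      ∫ y in Ioi (0 : ℝ), b y * φ (0, y) := by
    refine setIntegral_congr_fun measurableSet_Ioi fun y hy => ?_
    have hy' : 0 < y := hy
    simp only [source, hy', if_true]
    rw [max_eq_left (by linarith), add_zero]
  have h2 : ∫ y in (Ioi (0 : ℝ))ᶜ, source b I y * φ (max 0 (-y), y + max 0 (-y)) =
      ∫ t in Ioi (0 : ℝ), I t * φ (t, 0) := by
    -- the characteristics with `y ≤ 0` enter at `(t, x) = (-y, 0)`
    have h3 := integral_comp_neg_Iic (0 : ℝ) fun t => I t * φ (t, 0)
    rw [neg_zero] at h3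
    rw [compl_Ioi, ← h3]
    refine setIntegral_congr_fun measurableSet_Iic fun y hy => ?_
    have hy' : y ≤ 0 := hy
    simp only [source, not_lt.2 hy', if_false]
    rw [max_eq_right (by linarith), add_neg_cancel]
  rw [h1, h2]
  ring

end WeakFormulation

/-! ### Existence -/

section Existence

variable {b I : ℝ → ℝ}

/-- The population, as a function of time, driven by a prescribed activity `I`. -/
noncomputable def population (hρ : IsRegularRate ρ rM L) (h : IsInput rM b I) : C(ℝ≥0, L1Age) where
  toFun t := toAge (charDensity ρ b I t) (integrable_charDensity hρ h t.coe_nonneg) t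
  continuous_toFun := continuous_toAge (fun t => integrable_charDensity hρ h t.coe_nonneg)
    (tendsto_integral_abs_charDensity_sub hρ h)

theorem coeFn_population (hρ : IsRegularRate ρ rM L) (h : IsInput rM b I) (t : ℝ≥0) :
    population hρ h t =ᵐ[ageMeasure] fun x => charDensity ρ b I t (x - t) :=
  coeFn_toAge (integrable_charDensity hρ h t.coe_nonneg) t

theorem population_nonneg (hρ : IsRegularRate ρ rM L) (h : IsInput rM b I) (t : ℝ≥0) :
    ∀ᵐ x ∂ageMeasure, 0 ≤ population hρ h t x := by
  filter_upwards [coeFn_population hρ h t] with x hx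
  rw [hx]
  exact charDensity_nonneg h _ _

theorem integral_mul_population (hρ : IsRegularRate ρ rM L) (h : IsInput rM b I) (t : ℝ≥0)
    (w : ℝ → ℝ) :
    ∫ x in Ioi (0 : ℝ), w x * population hρ h t x =
      ∫ y, w (y + t) * charDensity ρ b I t y :=
  integral_mul_toAge (integrable_charDensity hρ h t.coe_nonneg) (fun _ => charDensity_of_le) w

theorem population_zero (hρ : IsRegularRate ρ rM L) (h : IsInput rM b I) :
    population hρ h 0 =ᵐ[ageMeasure] b := by
  filter_upwards [coeFn_population hρ h 0, ae_restrict_mem measurableSet_Ioi] with x hx hx0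
  have hx0' : 0 < x := hx0
  rw [hx, NNReal.coe_zero, sub_zero, charDensity_of_lt (by simpa using hx0'), survival_zero,
    mul_one, source, if_pos hx0']

theorem norm_population_le (hρ : IsRegularRate ρ rM L) (h : IsInput rM b I) (t : ℝ≥0) :
    ‖population hρ h t‖ ≤ ∫ y, charDensity ρ b I t y := by
  refine (norm_toAge_le (integrable_charDensity hρ h t.coe_nonneg) t).trans (le_of_eq ?_)
  simp_rw [abs_of_nonneg (charDensity_nonneg h _ _)]

theorem norm_population_sub_le {J : ℝ → ℝ} (hρ : IsRegularRate ρ rM L) (h : IsInput rM b I)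
    (hJ : IsInput rM b J) (t : ℝ≥0) :
    ‖population hρ h t - population hρ hJ t‖ ≤
      (1 + L * ((∫ y in Ioi 0, b y) + rM * t)) * ∫ s in (0 : ℝ)..t, |I s - J s| :=
  (norm_toAge_sub_le (integrable_charDensity hρ h t.coe_nonneg)
    (integrable_charDensity hρ hJ t.coe_nonneg) t).trans
    (integral_abs_charDensity_sub_le hρ h hJ t.coe_nonneg)

theorem weakFormulation_population (hρ : IsRegularRate ρ rM L) (h : IsInput rM b I)
    {φ : ℝ × ℝ → ℝ} (hφ : ContDiff ℝ ∞ φ) (hc : HasCompactSupport φ) :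
    (∫ t in Ioi (0 : ℝ), ∫ x in Ioi (0 : ℝ), population hρ h t.toNNReal x *
        (fderiv ℝ φ (t, x) (1, 1) - ρ x (I t) * φ (t, x)))
      + (∫ x in Ioi (0 : ℝ), b x * φ (0, x)) + (∫ t in Ioi (0 : ℝ), I t * φ (t, 0)) = 0 := by
  refine Eq.trans ?_ (weakFormulation_charDensity hρ h hφ hc)
  refine congrArg₂ _ (congrArg₂ _ ?_ rfl) rfl
  refine setIntegral_congr_fun measurableSet_Ioi fun t ht => ?_
  have ht0 : (t.toNNReal : ℝ) = t := Real.coe_toNNReal t (le_of_lt ht)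
  have := integral_mul_population hρ h t.toNNReal
    fun x => fderiv ℝ φ (t, x) (1, 1) - ρ x (I t) * φ (t, x)
  rw [ht0] at this
  simp_rw [mul_comm _ (fderiv ℝ φ _ _ - _)]
  exact this

/-- If at all times at least the activity is discharged, the total mass does not increase. -/
theorem integral_charDensity_le (hρ : IsRegularRate ρ rM L) (h : IsInput rM b I)
    (hI : ∀ s : ℝ≥0, I s ≤ discharge ρ (I s) (population hρ h s)) (t : ℝ≥0) :
    ∫ y, charDensity ρ b I t y ≤ ∫ y in Ioi 0, b y := by
  rw [integral_charDensity hρ h t.coe_nonneg]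
  have hint : IntervalIntegrable (fun s => ∫ y, ρ (y + s) (I s) * charDensity ρ b I s y)
      volume 0 t := by
    rw [intervalIntegrable_iff_integrableOn_Ioc_of_le t.coe_nonneg]
    exact (integrable_discharged hρ h t).integral_prod_left
  have := intervalIntegral.integral_mono_on t.coe_nonneg (h.intervalIntegrable_activity 0 t) hint
    fun s hs => by
      lift s to ℝ≥0 using hs.1
      have h1 := hI s
      rwa [discharge, integral_mul_population] at h1
  linarith

/-- The activity `u`, truncated to `[0, rM]` and extended to negative times by its value at `0`. -/
noncomputable def truncatedActivity (rM : ℝ) (u : C(ℝ≥0, ℝ)) (s : ℝ) : ℝ :=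
  max 0 (min rM (u s.toNNReal))

theorem isInput_truncatedActivity (hrM : 0 ≤ rM) (hb : Measurable b) (hb0 : ∀ y, 0 ≤ b y)
    (hbi : IntegrableOn b (Ioi 0)) (u : C(ℝ≥0, ℝ)) : IsInput rM b (truncatedActivity rM u) where
  measurable_initial := hb
  initial_nonneg := hb0
  integrableOn_initial := hbi
  measurable_activity := (continuous_const.max (continuous_const.min
    (u.continuous.comp continuous_real_toNNReal))).measurable
  activity_mem _ := ⟨le_max_left _ _, max_le hrM (min_le_left _ _)⟩

theorem abs_truncatedActivity_sub_le (u v : C(ℝ≥0, ℝ)) (s : ℝ) :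
    |truncatedActivity rM u s - truncatedActivity rM v s| ≤ |u s.toNNReal - v s.toNNReal| := by
  refine (abs_max_sub_max_le_max _ _ _ _).trans ?_
  rw [sub_self, abs_zero]
  refine max_le (abs_nonneg _) ((abs_min_sub_min_le_max _ _ _ _).trans ?_)
  rw [sub_self, abs_zero]
  exact max_le (abs_nonneg _) le_rfl

/-- For a given nonnegative initial density there is an activity `I` with values in `[0, rM]` such
that, in the population driven by `I`, the discharge is exactly `I`. -/
theorem exists_selfConsistent_activity (hρ : IsRegularRate ρ rM L) (hrM : 0 < rM) (hL : 0 ≤ L)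
    (hb : Measurable b) (hb0 : ∀ y, 0 ≤ b y) (hbi : IntegrableOn b (Ioi 0))
    (hb1 : ∫ y in Ioi 0, b y = 1) :
    ∃ (I : ℝ → ℝ) (h : IsInput rM b I), (∀ t, ‖population hρ h t‖ ≤ 1) ∧
      ∀ t : ℝ≥0, I t = discharge ρ (I t) (population hρ h t) := by
  have hin := isInput_truncatedActivity hrM.le hb hb0 hbi
  have hex : ∀ (u : C(ℝ≥0, ℝ)) (t : ℝ≥0), ∃ z ∈ Icc 0 rM,
      z = min rM (discharge ρ z (population hρ (hin u) t)) := fun u t =>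
    exists_cappedActivity hρ (population_nonneg hρ (hin u) t)
  choose A hA hAeq using hex
  have hAstab : ∀ u t v s, |A u t - A v s| ≤
      rM * ‖population hρ (hin u) t - population hρ (hin v) s‖ := fun u t v s =>
    abs_fixedPoint_sub_le_of_antitone
      (antitone_min_discharge hρ (population_nonneg hρ (hin u) t))
      (fun z => abs_min_discharge_sub_le hρ z _ _) (hAeq u t) (hAeq v s)
  have hAcont : ∀ u, Continuous (A u) := by
    refine fun u => continuous_iff_continuousAt.2 fun t₀ =>
      tendsto_iff_norm_sub_tendsto_zero.2 ?_
    refine squeeze_zero (fun _ => norm_nonneg _) (fun t => hAstab u t u t₀) ?_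
    have : Continuous fun t => rM * ‖population hρ (hin u) t - population hρ (hin u) t₀‖ := by
      fun_prop
    simpa using this.tendsto t₀
  have hC : 0 < rM * (1 + L + L * rM) := by positivity
  obtain ⟨u, hu⟩ := exists_fixedPoint_of_volterra (fun u => ⟨A u, hAcont u⟩) (M := rM) hC
    (fun u t => abs_le.2 ⟨by have := (hA u t).1; change -rM ≤ A u t; linarith, (hA u t).2⟩)
    (fun u v t => by
      have h1 := norm_population_sub_le hρ (hin u) (hin v) t
      have h2 : ∫ s in (0 : ℝ)..t, |truncatedActivity rM u s - truncatedActivity rM v s| ≤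
          ∫ s in (0 : ℝ)..t, |u s.toNNReal - v s.toNNReal| := by
        refine intervalIntegral.integral_mono_on t.coe_nonneg ?_ ?_ fun s _ =>
          abs_truncatedActivity_sub_le u v s
        · exact (((hin u).intervalIntegrable_activity 0 t).sub
            ((hin v).intervalIntegrable_activity 0 t)).abs
        · exact intervalIntegrable_comp_toNNReal (u := fun s => |u s - v s|) (by fun_prop) _ _
      have h3 : 0 ≤ ∫ s in (0 : ℝ)..t, |u s.toNNReal - v s.toNNReal| :=
        intervalIntegral.integral_nonneg t.coe_nonneg fun _ _ => abs_nonneg _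
      have ht : (0 : ℝ) ≤ t := t.coe_nonneg
      rw [hb1] at h1
      calc |A u t - A v t| ≤ rM * ‖population hρ (hin u) t - population hρ (hin v) t‖ :=
            hAstab u t v t
        _ ≤ rM * ((1 + L * (1 + rM * t)) * ∫ s in (0 : ℝ)..t, |u s.toNNReal - v s.toNNReal|) := by
            refine mul_le_mul_of_nonneg_left (h1.trans ?_) hrM.le
            exact mul_le_mul_of_nonneg_left h2 (by positivity)
        _ ≤ rM * (((1 + L + L * rM) * (1 + t)) *
              ∫ s in (0 : ℝ)..t, |u s.toNNReal - v s.toNNReal|) := by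
            refine mul_le_mul_of_nonneg_left (mul_le_mul_of_nonneg_right ?_ h3) hrM.le
            have h5 : 0 ≤ L * t := by positivity
            have h6 : 0 ≤ L * rM := by positivity
            nlinarith
        _ = _ := by ring)
  have hAu : ∀ t, A u t = u t := fun t => congrArg (fun f : C(ℝ≥0, ℝ) => f t) hu
  have hI : ∀ t : ℝ≥0, truncatedActivity rM u t = A u t := by
    intro t
    rw [truncatedActivity, Real.toNNReal_coe, ← hAu, min_eq_right (hA u t).2,
      max_eq_right (hA u t).1]
  have hle : ∀ t, ‖population hρ (hin u) t‖ ≤ 1 := by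
    intro t
    rw [← hb1]
    refine (norm_population_le hρ (hin u) t).trans (integral_charDensity_le hρ (hin u) ?_ t)
    intro s
    rw [hI]
    exact (hAeq u s).trans_le (min_le_right _ _)
  refine ⟨truncatedActivity rM u, hin u, hle, fun t => ?_⟩
  -- the population has mass at most one, so that the cap at `rM` is not active
  have hcap : discharge ρ (A u t) (population hρ (hin u) t) ≤ rM := by
    refine (le_abs_self _).trans ((abs_integral_bounded_mul_le (fun x => hρ.abs_le x _) _).trans ?_)
    exact mul_le_of_le_one_right hrM.le (hle t)
  rw [hI]
  exact (hAeq u t).trans (min_eq_right hcap)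

theorem exists_isSolution (hρ : IsRegularRate ρ rM L) (hrM : 0 < rM) (hL : 0 ≤ L) {nIni : ℝ → ℝ}
    (hint : IntegrableOn nIni (Ioi 0)) (hnonneg : ∀ᵐ x ∂ageMeasure, 0 ≤ nIni x)
    (hmass : ∫ x in Ioi (0 : ℝ), nIni x = 1) :
    ∃ (n : C(ℝ≥0, L1Age)) (I : ℝ≥0 → ℝ), IsSolution ρ rM nIni n I ∧
      (∀ t, ∀ᵐ x ∂ageMeasure, 0 ≤ n t x) ∧ ∀ t, ‖n t‖ ≤ 1 := by
  obtain ⟨b, hb, hb0, hbn⟩ : ∃ b : ℝ → ℝ, Measurable b ∧ (∀ y, 0 ≤ b y) ∧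
      nIni =ᵐ[ageMeasure] b := by
    refine ⟨fun y => max 0 (hint.1.mk nIni y),
      measurable_const.max hint.1.stronglyMeasurable_mk.measurable, fun y => le_max_left _ _, ?_⟩
    filter_upwards [hint.1.ae_eq_mk, hnonneg] with y hy hy0
    rw [← hy, max_eq_right hy0]
  have hbi : IntegrableOn b (Ioi 0) := hint.congr hbn
  have hb1 : ∫ y in Ioi 0, b y = 1 := by rw [← hmass]; exact (integral_congr_ae hbn).symm
  obtain ⟨I, h, hle, hI⟩ := exists_selfConsistent_activity hρ hrM hL hb hb0 hbi hb1
  refine ⟨population hρ h, fun t => I t, ⟨?_, ?_, hI, ?_, ?_⟩, population_nonneg hρ h, hle⟩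
  · exact h.measurable_activity.comp measurable_subtype_coe
  · exact fun t => h.activity_mem t
  · exact (population_zero hρ h).trans hbn.symm
  · intro φ hφ hc
    refine Eq.trans ?_ (weakFormulation_population hρ h hφ hc)
    have hcoe : ∀ t ∈ Ioi (0 : ℝ), (t.toNNReal : ℝ) = t := fun t ht =>
      Real.coe_toNNReal t (le_of_lt ht)
    refine congrArg₂ _ (congrArg₂ _ ?_ ?_) ?_
    · refine setIntegral_congr_fun measurableSet_Ioi fun t ht => ?_
      simp only [hcoe t ht]
    · refine integral_congr_ae ?_
      filter_upwards [hbn] with x hx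
      rw [hx]
    · refine setIntegral_congr_fun measurableSet_Ioi fun t ht => ?_
      simp only [hcoe t ht]

end Existence

/-! ### Weak solutions of ordinary differential equations -/

/-- Every test function is, on positive times, the derivative of a test function: its primitive
vanishing at `+∞`, cut off at negative times. -/
theorem exists_hasCompactSupport_deriv_eq {g : ℝ → ℝ} (hg : ContDiff ℝ ∞ g)
    (hc : HasCompactSupport g) :
    ∃ χ : ℝ → ℝ, ContDiff ℝ ∞ χ ∧ HasCompactSupport χ ∧ ∀ t, 0 < t → deriv χ t = g t := by
  obtain ⟨R, hR0, hR⟩ := hc.isCompact.isBounded.subset_ball_lt 0 (0 : ℝ)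
  have hgR : ∀ t, R ≤ t → g t = 0 := fun t ht =>
    image_eq_zero_of_notMem_tsupport fun hm => by
      have := mem_ball_zero_iff.1 (hR hm)
      rw [Real.norm_eq_abs] at this
      exact absurd ((le_abs_self t).trans_lt this) (not_lt.2 ht)
  let P : ℝ → ℝ := fun t => ∫ s in R..t, g s
  have hPd : ∀ t, HasDerivAt P (g t) t := fun t =>
    hg.continuous.integral_hasStrictDerivAt R t |>.hasDerivAt
  have hP : ContDiff ℝ ∞ P := by
    rw [contDiff_infty_iff_deriv]
    refine ⟨fun t => (hPd t).differentiableAt, ?_⟩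
    rwa [funext fun t => (hPd t).deriv]
  have hPR : ∀ t, R ≤ t → P t = 0 := fun t ht => by
    refine intervalIntegral.integral_zero_ae (Eventually.of_forall fun s hs => ?_)
    rw [uIoc_of_le ht] at hs
    exact hgR s hs.1.le
  -- the cutoff is one on the part of `(0, ∞)` where the primitive does not vanish
  let θ : ContDiffBump (0 : ℝ) := ⟨R, R + 1, hR0, by linarith⟩
  refine ⟨fun t => θ t * P t, θ.contDiff.mul hP, θ.hasCompactSupport.mul_right, fun t ht => ?_⟩
  have hd : HasDerivAt (fun t => θ t * P t) (deriv θ t * P t + θ t * g t) t :=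
    ((θ.contDiff (n := 1)).differentiable (by simp) t).hasDerivAt.mul (hPd t)
  rw [hd.deriv]
  by_cases htR : t < R
  · have h1 : θ =ᶠ[𝓝 t] 1 := θ.eventuallyEq_one_of_mem_ball (by
      rw [mem_ball_zero_iff, Real.norm_of_nonneg ht.le]; exact htR)
    have h2 : deriv θ t = 0 := by rw [h1.deriv_eq]; exact deriv_const t 1
    rw [h2, h1.self_of_nhds]
    simp
  · rw [hPR t (not_lt.1 htR), hgR t (not_lt.1 htR)]
    simp

/-- A continuous weak solution `P` of `P' = -G`, `P 0 = P₀` on `[0, ∞)` is given by integration. -/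
theorem eq_sub_integral_of_weak {P G : ℝ → ℝ} {P₀ : ℝ} (hP : Continuous P)
    (hG : LocallyIntegrable G)
    (hweak : ∀ χ : ℝ → ℝ, ContDiff ℝ ∞ χ → HasCompactSupport χ →
      (∫ t in Ioi (0 : ℝ), (deriv χ t * P t - χ t * G t)) + χ 0 * P₀ = 0)
    {t : ℝ} (ht : 0 ≤ t) : P t = P₀ - ∫ s in (0 : ℝ)..t, G s := by
  have hGi : ∀ a c, IntervalIntegrable G volume a c := fun a c =>
    (hG.integrableOn_isCompact isCompact_uIcc).intervalIntegrable
  set H : ℝ → ℝ := fun t => P₀ - ∫ s in (0 : ℝ)..t, G s with hHdef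
  have hH : Continuous H :=
    continuous_const.sub (intervalIntegral.continuous_primitive hGi 0)
  have hHd : ∀ᵐ t, HasDerivAt H (-G t) t := by
    filter_upwards [LocallyIntegrable.ae_hasDerivAt_integral hG] with t ht
    exact (ht 0).const_sub P₀
  have hint : ∀ (F : ℝ → ℝ), Continuous F → ∀ χ : ℝ → ℝ, ContDiff ℝ ∞ χ → HasCompactSupport χ →
      Integrable (fun t => deriv χ t * F t - χ t * G t) (volume.restrict (Ioi 0)) := by
    intro F hF χ hχ hc
    refine Integrable.restrict (Integrable.sub ?_ ?_)
    · exact ((hχ.continuous_deriv (by simp)).mul hF).integrable_of_hasCompactSupport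
        (hc.deriv.mul_right)
    · exact hG.integrable_smul_left_of_hasCompactSupport hχ.continuous hc
  -- `H` satisfies the same weak identity, so that `P - H` is orthogonal to all `χ'`
  have hHweak : ∀ χ : ℝ → ℝ, ContDiff ℝ ∞ χ → HasCompactSupport χ →
      ∫ t in Ioi (0 : ℝ), (deriv χ t * H t - χ t * G t) = -(χ 0 * P₀) := by
    intro χ hχ hc
    obtain ⟨R, hR0, hR⟩ := hc.isCompact.isBounded.subset_ball_lt 0 (0 : ℝ)
    have h := integral_Ioi_of_ae_hasDerivAt_of_eq_zero (f := fun t => χ t * H t)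
      (f' := fun t => deriv χ t * H t + χ t * -G t) (a := 0) (R := R)
      (fun c _ => by
        have h1 : ContDiff ℝ 1 χ := hχ.of_le (by simp)
        refine h1.contDiffOn.absolutelyContinuousOnInterval.fun_mul ?_
        have h2 : AbsolutelyContinuousOnInterval (fun _ : ℝ => P₀) 0 c :=
          (contDiff_const (n := 1)).contDiffOn.absolutelyContinuousOnInterval
        exact h2.sub ((hGi 0 c).absolutelyContinuousOnInterval_intervalIntegral (by simp)))
      (by
        filter_upwards [hHd] with t ht _
        exact ((hχ.differentiable (by simp)) t).hasDerivAt.mul ht)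
      (fun t ht => by
        have : χ t = 0 := image_eq_zero_of_notMem_tsupport fun hm => by
          have := mem_ball_zero_iff.1 (hR hm)
          rw [Real.norm_eq_abs] at this
          exact absurd ((le_abs_self t).trans_lt this) (not_lt.2 ht)
        rw [this, zero_mul])
    have h0 : H 0 = P₀ := by simp [hHdef]
    rw [h0] at h
    rw [← h]
    refine integral_congr_ae (Eventually.of_forall fun t => ?_)
    ring
  have hae : ∀ᵐ t, t ∈ Ioi (0 : ℝ) → P t - H t = 0 := by
    refine isOpen_Ioi.ae_eq_zero_of_integral_contDiff_smul_eq_zero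
      ((hP.sub hH).locallyIntegrable.locallyIntegrableOn _) fun g hg hc hsupp => ?_
    obtain ⟨χ, hχ, hχc, hχg⟩ := exists_hasCompactSupport_deriv_eq hg hc
    have h1 : ∫ t, g t • (P t - H t) = ∫ t in Ioi (0 : ℝ), g t • (P t - H t) := by
      refine (setIntegral_eq_integral_of_forall_compl_eq_zero fun t ht => ?_).symm
      rw [image_eq_zero_of_notMem_tsupport fun hm => ht (hsupp hm), zero_smul]
    have h2 : ∫ t in Ioi (0 : ℝ), g t • (P t - H t) = ∫ t in Ioi (0 : ℝ),
        ((deriv χ t * P t - χ t * G t) - (deriv χ t * H t - χ t * G t)) := by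
      refine setIntegral_congr_fun measurableSet_Ioi fun t ht => ?_
      simp only [hχg t ht, smul_eq_mul]
      ring
    rw [h1, h2, integral_sub (hint P hP χ hχ hχc) (hint H hH χ hχ hχc), hHweak χ hχ hχc]
    linarith [hweak χ hχ hχc]
  have heq : EqOn P H (Ici 0) := by
    refine Measure.eqOn_of_ae_eq (μ := volume) ?_ hP.continuousOn hH.continuousOn (by simp)
    rw [← restrict_Ioi_eq_restrict_Ici]
    filter_upwards [(ae_restrict_iff' measurableSet_Ioi).2 hae] with t ht
    exact sub_eq_zero.1 ht
  exact heq ht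

/-! ### The norm of `L¹` by duality -/

/-- The `L¹` norm is the supremum of the pairings with test functions bounded by one. -/
theorem norm_le_of_forall_integral_le {f : L1Age} {K : ℝ}
    (h : ∀ η : ℝ → ℝ, ContDiff ℝ ∞ η → HasCompactSupport η → (∀ x, |η x| ≤ 1) →
      ∫ x in Ioi (0 : ℝ), η x * f x ≤ K) : ‖f‖ ≤ K := by
  refine le_of_forall_pos_le_add fun ε hε => ?_
  have hfi := L1.integrable_coeFn f
  obtain ⟨g, hgc, hg, hfg⟩ := MemLp.exist_eLpNorm_sub_le (μ := ageMeasure) ENNReal.one_ne_top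
    le_rfl (Lp.memLp f) (half_pos hε)
  have hgi : Integrable g ageMeasure := hg.continuous.integrable_of_hasCompactSupport hgc
  have hdist : ∫ x in Ioi (0 : ℝ), |f x - g x| ≤ ε / 2 := by
    have h1 := (hfi.sub hgi)
    rw [eLpNorm_one_eq_lintegral_enorm] at hfg
    have h2 := integral_norm_eq_lintegral_enorm h1.aestronglyMeasurable
    refine (le_of_eq h2).trans ?_
    exact ENNReal.toReal_le_of_le_ofReal (half_pos hε).le hfg
  have hdisti : Integrable (fun x => |f x - g x|) ageMeasure := (hfi.sub hgi).norm
  -- `g / √(g² + δ)` are smooth approximations of the sign of `g`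
  let η : ℕ → ℝ → ℝ := fun k x => g x / Real.sqrt (g x ^ 2 + 1 / ((k : ℝ) + 1))
  have hpos : ∀ (k : ℕ) (x : ℝ), 0 < g x ^ 2 + 1 / ((k : ℝ) + 1) := fun k x =>
    add_pos_of_nonneg_of_pos (sq_nonneg _) (by positivity)
  have hη1 : ∀ k x, |η k x| ≤ 1 := fun k x => by
    rw [abs_div, abs_of_pos (Real.sqrt_pos.2 (hpos k x)),
      div_le_one (Real.sqrt_pos.2 (hpos k x))]
    refine Real.abs_le_sqrt ?_
    have : 0 ≤ 1 / ((k : ℝ) + 1) := by positivity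
    linarith
  have hηs : ∀ k, ContDiff ℝ ∞ (η k) := fun k =>
    hg.div (((hg.pow 2).add contDiff_const).sqrt fun x => (hpos k x).ne')
      fun x => (Real.sqrt_pos.2 (hpos k x)).ne'
  have hηc : ∀ k, HasCompactSupport (η k) := fun k => by
    have := hgc.mul_right (f' := fun x => (Real.sqrt (g x ^ 2 + 1 / ((k : ℝ) + 1)))⁻¹)
    exact this
  have hlim : Tendsto (fun k => ∫ x in Ioi (0 : ℝ), η k x * g x) atTop
      (𝓝 (∫ x in Ioi (0 : ℝ), |g x|)) := by
    refine tendsto_integral_of_dominated_convergence (fun x => |g x|)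
      (fun k => ((hηs k).continuous.mul hg.continuous).aestronglyMeasurable) hgi.norm
      (fun k => Eventually.of_forall fun x => ?_) (Eventually.of_forall fun x => ?_)
    · rw [norm_mul]
      exact mul_le_of_le_one_left (norm_nonneg _) (hη1 k x)
    · have h1 : Tendsto (fun k : ℕ => Real.sqrt (g x ^ 2 + 1 / ((k : ℝ) + 1))) atTop
          (𝓝 (Real.sqrt (g x ^ 2 + 0))) :=
        (Real.continuous_sqrt.tendsto _).comp
          (tendsto_const_nhds.add tendsto_one_div_add_atTop_nhds_zero_nat)
      rw [add_zero, Real.sqrt_sq_eq_abs] at h1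
      by_cases hx : g x = 0
      · simp [η, hx]
      · have h2 := ((tendsto_const_nhds (x := g x)).div h1 (abs_ne_zero.2 hx)).mul_const (g x)
        have h3 : g x / |g x| * g x = |g x| := by
          rw [div_mul_eq_mul_div, ← abs_mul_abs_self (g x)]
          exact mul_div_cancel_right₀ _ (abs_ne_zero.2 hx)
        rwa [h3] at h2
  have hgK : ∫ x in Ioi (0 : ℝ), |g x| ≤ K + ε / 2 := by
    refine le_of_tendsto' hlim fun k => ?_
    have hif := integrable_bounded_mul (hηs k).continuous.aestronglyMeasurable (hη1 k) f
    calc ∫ x in Ioi (0 : ℝ), η k x * g x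
        ≤ ∫ x in Ioi (0 : ℝ), (η k x * f x + |f x - g x|) := by
          refine integral_mono (hgi.bdd_mul (hηs k).continuous.aestronglyMeasurable
            (Eventually.of_forall (hη1 k))) (hif.add hdisti) fun x => ?_
          have h1 : η k x * (g x - f x) ≤ |f x - g x| := by
            refine (le_abs_self _).trans ?_
            rw [abs_mul, abs_sub_comm (g x)]
            exact mul_le_of_le_one_left (abs_nonneg _) (hη1 k x)
          simp only
          linarith
      _ = (∫ x in Ioi (0 : ℝ), η k x * f x) + ∫ x in Ioi (0 : ℝ), |f x - g x| :=
          integral_add hif hdisti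
      _ ≤ K + ε / 2 := add_le_add (h _ (hηs k) (hηc k) (hη1 k)) hdist
  rw [L1.norm_eq_integral_norm]
  calc ∫ x in Ioi (0 : ℝ), ‖f x‖ ≤ ∫ x in Ioi (0 : ℝ), (|g x| + |f x - g x|) := by
        refine integral_mono hfi.norm (hgi.norm.add hdisti) fun x => ?_
        have := abs_add_le (g x) (f x - g x)
        rwa [add_sub_cancel] at this
    _ = (∫ x in Ioi (0 : ℝ), |g x|) + ∫ x in Ioi (0 : ℝ), |f x - g x| :=
        integral_add hgi.norm hdisti
    _ ≤ K + ε := by linarith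

/-! ### Pairings of weak solutions with transported test functions -/

section Pairing

variable {nIni : ℝ → ℝ} {n : C(ℝ≥0, L1Age)} {I : ℝ≥0 → ℝ} {η : ℝ → ℝ} {C : ℝ}

theorem continuous_pairing (n : C(ℝ≥0, L1Age)) (hη : Continuous η) (hC : ∀ x, |η x| ≤ C) :
    Continuous fun t : ℝ => ∫ x in Ioi (0 : ℝ), η (x - t) * n t.toNNReal x := by
  have h : Continuous fun p : L1Age × ℝ => ∫ x in Ioi (0 : ℝ), η (x - p.2) * p.1 x := by
    refine continuous_prod_of_continuous_lipschitzWith _ C.toNNReal (fun f => ?_) fun t => ?_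
    · refine continuous_of_dominated (bound := fun x => C * |f x|) (fun t => ?_) (fun t => ?_)
        ((L1.integrable_coeFn f).norm.const_mul C) ?_
      · exact (integrable_bounded_mul (w := fun x => η (x - t))
          (by fun_prop) (fun x => hC _) f).aestronglyMeasurable
      · refine Eventually.of_forall fun x => ?_
        rw [norm_mul]
        exact mul_le_mul_of_nonneg_right (hC _) (norm_nonneg _)
      · refine Eventually.of_forall fun x => ?_
        change Continuous fun t => η (x - t) * f x
        fun_prop
    · refine LipschitzWith.of_dist_le_mul fun f g => ?_
      rw [Real.coe_toNNReal _ ((abs_nonneg _).trans (hC 0)), Real.dist_eq, dist_eq_norm,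
        ← integral_bounded_mul_sub (w := fun x => η (x - t)) (by fun_prop) (fun x => hC _)]
      exact abs_integral_bounded_mul_le (w := fun x => η (x - t)) (fun x => hC _) _
  exact h.comp ((n.continuous.comp continuous_real_toNNReal).prodMk continuous_id)

/-- The rate at which discharge decreases the pairing of `n` with the transported test function
`η (x - t)`. -/
noncomputable def dischargePairing (ρ : ℝ → ℝ → ℝ) (η : ℝ → ℝ) (n : C(ℝ≥0, L1Age)) (I : ℝ≥0 → ℝ)
    (t : ℝ) : ℝ :=
  ∫ x in Ioi (0 : ℝ), (ρ x (I t.toNNReal) * η (x - t)) * n t.toNNReal x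

theorem IsRegularRate.measurable_mul_test (hρ : IsRegularRate ρ rM L) (hη : Continuous η)
    (z t : ℝ) : Measurable fun x => ρ x z * η (x - t) :=
  (hρ.measurable_left z).mul (by fun_prop)

theorem IsRegularRate.abs_mul_test_le (hρ : IsRegularRate ρ rM L) (hC : ∀ x, |η x| ≤ C)
    (z t x : ℝ) : |ρ x z * η (x - t)| ≤ rM * C := by
  rw [abs_mul]
  exact mul_le_mul (hρ.abs_le _ _) (hC _) (abs_nonneg _) hρ.rM_nonneg

theorem abs_dischargePairing_le (hρ : IsRegularRate ρ rM L) (hC : ∀ x, |η x| ≤ C) (t : ℝ) :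
    |dischargePairing ρ η n I t| ≤ rM * C * ‖n t.toNNReal‖ :=
  abs_integral_bounded_mul_le (hρ.abs_mul_test_le hC _ t) _

theorem measurable_dischargePairing (hρ : IsRegularRate ρ rM L) (hη : Continuous η)
    (hC : ∀ x, |η x| ≤ C) (n : C(ℝ≥0, L1Age)) (hI : Measurable I) :
    Measurable (dischargePairing ρ η n I) := by
  -- `t ↦ (n t, t)` is composed with a Carathéodory function of `(f, t)`: Lipschitz in `f`,
  -- measurable in `t`
  borelize L1Age
  have : Fact ((1 : ℝ≥0∞) ≠ ⊤) := ⟨ENNReal.one_ne_top⟩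
  have h : Measurable (Function.uncurry fun (f : L1Age) (t : ℝ) =>
      ∫ x in Ioi (0 : ℝ), (ρ x (I t.toNNReal) * η (x - t)) * f x) := by
    refine measurable_uncurry_of_continuous_of_measurable (fun t => ?_) fun f => ?_
    · refine LipschitzWith.continuous (K := (rM * C).toNNReal)
        (LipschitzWith.of_dist_le_mul fun f g => ?_)
      have h0 : 0 ≤ rM * C := mul_nonneg hρ.rM_nonneg ((abs_nonneg _).trans (hC 0))
      rw [Real.coe_toNNReal _ h0, Real.dist_eq, dist_eq_norm,
        ← integral_bounded_mul_sub (hρ.measurable_mul_test hη _ t).aestronglyMeasurable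
          (hρ.abs_mul_test_le hC _ t)]
      exact abs_integral_bounded_mul_le (hρ.abs_mul_test_le hC _ t) _
    · have h1 : Measurable fun p : ℝ × ℝ =>
          (ρ p.2 (I p.1.toNNReal) * η (p.2 - p.1)) * f p.2 := by
        have h2 : Measurable fun p : ℝ × ℝ => ρ p.2 (I p.1.toNNReal) :=
          hρ.measurable.comp (measurable_snd.prodMk
            (hI.comp (measurable_real_toNNReal.comp measurable_fst)))
        have h3 : Measurable fun p : ℝ × ℝ => η (p.2 - p.1) :=
          (hη.comp (continuous_snd.sub continuous_fst)).measurable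
        exact (h2.mul h3).mul ((Lp.stronglyMeasurable f).measurable.comp measurable_snd)
      exact (h1.stronglyMeasurable.integral_prod_right (ν := ageMeasure)).measurable
  exact h.comp (((n.continuous.comp continuous_real_toNNReal).measurable).prodMk measurable_id)

theorem locallyIntegrable_dischargePairing (hρ : IsRegularRate ρ rM L) (hη : Continuous η)
    (hC : ∀ x, |η x| ≤ C) (n : C(ℝ≥0, L1Age)) (hI : Measurable I) :
    LocallyIntegrable (dischargePairing ρ η n I) := by
  have hcont : Continuous fun t : ℝ => rM * C * ‖n t.toNNReal‖ :=
    continuous_const.mul (n.continuous.comp continuous_real_toNNReal).norm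
  exact hcont.locallyIntegrable.mono
    (measurable_dischargePairing hρ hη hC n hI).aestronglyMeasurable
    (Eventually.of_forall fun t => (abs_dischargePairing_le hρ hC t).trans (le_abs_self _))

theorem IsSolution.locallyIntegrable_activity_mul (hs : IsSolution ρ rM nIni n I)
    (hη : Continuous η) : LocallyIntegrable fun t : ℝ => I t.toNNReal * η (-t) := by
  have hcont : Continuous fun t : ℝ => rM * |η (-t)| := by fun_prop
  refine hcont.locallyIntegrable.mono ((hs.activity_measurable.comp measurable_real_toNNReal).mul
    (by fun_prop : Measurable fun t : ℝ => η (-t))).aestronglyMeasurable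
    (Eventually.of_forall fun t => ?_)
  refine le_trans ?_ (le_abs_self _)
  have h1 := hs.activity_mem_Icc t.toNNReal
  rw [norm_mul, Real.norm_of_nonneg h1.1]
  exact mul_le_mul_of_nonneg_right h1.2 (abs_nonneg _)

theorem hasCompactSupport_mul_comp_sub {χ η : ℝ → ℝ} (hχ : HasCompactSupport χ)
    (hη : HasCompactSupport η) :
    HasCompactSupport fun p : ℝ × ℝ => χ p.1 * η (p.2 - p.1) := by
  have hK : IsCompact ((fun p : ℝ × ℝ => (p.1, p.2 + p.1)) '' (tsupport χ ×ˢ tsupport η)) :=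
    (hχ.isCompact.prod hη.isCompact).image (by fun_prop)
  refine HasCompactSupport.intro hK fun p hp => ?_
  by_contra hne
  refine hp ⟨(p.1, p.2 - p.1), ⟨?_, ?_⟩, by simp⟩
  · exact subset_tsupport _ (left_ne_zero_of_mul hne)
  · exact subset_tsupport _ (right_ne_zero_of_mul hne)

/-- Test functions constant along characteristics, up to a factor depending on time, turn the
transport equation into an ordinary differential equation. -/
theorem IsSolution.pairing_eq (hρ : IsRegularRate ρ rM L) (hs : IsSolution ρ rM nIni n I)
    (hη : ContDiff ℝ ∞ η) (hηc : HasCompactSupport η) (t : ℝ≥0) :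
    ∫ x in Ioi (0 : ℝ), η (x - t) * n t x = (∫ x in Ioi (0 : ℝ), nIni x * η x) -
      ∫ s in (0 : ℝ)..t, (dischargePairing ρ η n I s - I s.toNNReal * η (-s)) := by
  obtain ⟨C, hC⟩ := hηc.exists_bound_of_continuous hη.continuous
  have hQ := locallyIntegrable_dischargePairing hρ hη.continuous hC n hs.activity_measurable
  have hB := hs.locallyIntegrable_activity_mul hη.continuous
  have hP := continuous_pairing n hη.continuous hC
  have key := eq_sub_integral_of_weak (P₀ := ∫ x in Ioi (0 : ℝ), nIni x * η x) hP (hQ.sub hB)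
    (fun χ hχ hχc => ?_) t.coe_nonneg
  · simpa using key
  let φ : ℝ × ℝ → ℝ := fun p => χ p.1 * η (p.2 - p.1)
  have hφ : ContDiff ℝ ∞ φ :=
    (hχ.comp contDiff_fst).mul (hη.comp (contDiff_snd.sub contDiff_fst))
  have hφd : ∀ t x, fderiv ℝ φ (t, x) (1, 1) = deriv χ t * η (x - t) := by
    intro t x
    have h1 := hasDerivAt_comp_characteristic (hφ.differentiable (by simp)) (x - t) t
    have h2 : HasDerivAt (fun s => φ (s, x - t + s)) (deriv χ t * η (x - t)) t := by
      have h3 : (fun s => φ (s, x - t + s)) = fun s => χ s * η (x - t) := by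
        funext s
        simp only [φ, add_sub_cancel_right]
      rw [h3]
      exact ((hχ.differentiable (by simp)) t).hasDerivAt.mul_const _
    rw [sub_add_cancel] at h1
    exact h1.unique h2
  have htr := hs.transport φ hφ (hasCompactSupport_mul_comp_sub hχc hηc)
  have hinner : ∀ t : ℝ, ∫ x in Ioi (0 : ℝ), n t.toNNReal x *
      (fderiv ℝ φ (t, x) (1, 1) - ρ x (I t.toNNReal) * φ (t, x)) =
      deriv χ t * (∫ x in Ioi (0 : ℝ), η (x - t) * n t.toNNReal x) -
        χ t * dischargePairing ρ η n I t := by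
    intro t
    have hi1 := integrable_bounded_mul (w := fun x => η (x - t))
      (by have := hη.continuous; fun_prop) (fun x => hC _) (n t.toNNReal)
    have hi2 := integrable_bounded_mul
      (hρ.measurable_mul_test hη.continuous (I t.toNNReal) t).aestronglyMeasurable
      (hρ.abs_mul_test_le hC _ t) (n t.toNNReal)
    rw [dischargePairing, ← integral_const_mul, ← integral_const_mul,
      ← integral_sub (hi1.const_mul _) (hi2.const_mul _)]
    refine integral_congr_ae (Eventually.of_forall fun x => ?_)
    simp only [hφd, φ]
    ring
  have hini : ∫ x in Ioi (0 : ℝ), nIni x * φ (0, x) =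
      χ 0 * ∫ x in Ioi (0 : ℝ), nIni x * η x := by
    rw [← integral_const_mul]
    refine integral_congr_ae (Eventually.of_forall fun x => ?_)
    simp only [φ, sub_zero]
    ring
  have hbdry : ∫ t in Ioi (0 : ℝ), I t.toNNReal * φ (t, 0) =
      ∫ t in Ioi (0 : ℝ), χ t * (I t.toNNReal * η (-t)) := by
    refine integral_congr_ae (Eventually.of_forall fun t => ?_)
    simp only [φ, zero_sub]
    ring
  simp_rw [hinner] at htr
  rw [hini, hbdry] at htr
  have hi1 : Integrable (fun t => deriv χ t *
      (∫ x in Ioi (0 : ℝ), η (x - t) * n t.toNNReal x) - χ t * dischargePairing ρ η n I t)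
      (volume.restrict (Ioi 0)) :=
    Integrable.restrict ((((hχ.continuous_deriv (by simp)).mul hP).integrable_of_hasCompactSupport
      hχc.deriv.mul_right).sub
      (hQ.integrable_smul_left_of_hasCompactSupport hχ.continuous hχc))
  have hi2 : Integrable (fun t => χ t * (I t.toNNReal * η (-t))) (volume.restrict (Ioi 0)) :=
    Integrable.restrict (hB.integrable_smul_left_of_hasCompactSupport hχ.continuous hχc)
  have hsum := integral_add hi1 hi2
  have hcongr : ∫ t in Ioi (0 : ℝ), (deriv χ t *
      (∫ x in Ioi (0 : ℝ), η (x - t) * n t.toNNReal x) -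
      χ t * (dischargePairing ρ η n I - fun t => I t.toNNReal * η (-t)) t) =
      ∫ t in Ioi (0 : ℝ), ((deriv χ t *
      (∫ x in Ioi (0 : ℝ), η (x - t) * n t.toNNReal x) - χ t * dischargePairing ρ η n I t) +
      χ t * (I t.toNNReal * η (-t))) := by
    refine integral_congr_ae (Eventually.of_forall fun t => ?_)
    simp only [Pi.sub_apply]
    ring
  rw [hcongr, hsum]
  linarith

end Pairing

/-! ### Uniqueness -/

section Uniqueness

variable {nIni : ℝ → ℝ} {n m : C(ℝ≥0, L1Age)} {I J : ℝ≥0 → ℝ}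

/-- Only one of the two populations has to be nonnegative. -/
theorem IsSolution.abs_activity_sub_le (hρ : IsRegularRate ρ rM L)
    (hn : IsSolution ρ rM nIni n I) (hm : IsSolution ρ rM nIni m J)
    (hm0 : ∀ t, ∀ᵐ x ∂ageMeasure, 0 ≤ m t x) (t : ℝ≥0) :
    |I t - J t| ≤ rM * ‖n t - m t‖ := by
  rw [abs_sub_comm, norm_sub_rev]
  exact abs_fixedPoint_sub_le_of_antitone (antitone_discharge hρ (hm0 t))
    (fun z => abs_discharge_sub_le hρ z _ _) (hm.activity_eq t) (hn.activity_eq t)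

theorem IsSolution.abs_dischargePairing_sub_le (hρ : IsRegularRate ρ rM L) (hL : 0 ≤ L)
    (hn : IsSolution ρ rM nIni n I) (hm : IsSolution ρ rM nIni m J)
    (hm0 : ∀ t, ∀ᵐ x ∂ageMeasure, 0 ≤ m t x) (hm1 : ∀ t, ‖m t‖ ≤ 1)
    {η : ℝ → ℝ} (hη : Continuous η) (hη1 : ∀ x, |η x| ≤ 1) (s : ℝ) :
    |dischargePairing ρ η n I s - dischargePairing ρ η m J s| ≤
      (rM + L * rM) * ‖n s.toNNReal - m s.toNNReal‖ := by
  have hmeas := fun z => (hρ.measurable_mul_test hη z s).aestronglyMeasurable (μ := ageMeasure)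
  have hbd := fun z => hρ.abs_mul_test_le hη1 z s
  have hdiff : ∀ x, |ρ x (I s.toNNReal) * η (x - s) - ρ x (J s.toNNReal) * η (x - s)| ≤
      L * |I s.toNNReal - J s.toNNReal| := by
    intro x
    rw [← sub_mul, abs_mul]
    exact (mul_le_of_le_one_right (abs_nonneg _) (hη1 _)).trans (hρ.lipschitz _ _ _)
  have hsplit : dischargePairing ρ η n I s - dischargePairing ρ η m J s =
      (∫ x in Ioi (0 : ℝ), (ρ x (I s.toNNReal) * η (x - s)) *
        (n s.toNNReal - m s.toNNReal : L1Age) x) +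
      ∫ x in Ioi (0 : ℝ), (ρ x (I s.toNNReal) * η (x - s) - ρ x (J s.toNNReal) * η (x - s)) *
        m s.toNNReal x := by
    rw [integral_bounded_mul_sub (hmeas _) (hbd _)]
    simp_rw [sub_mul]
    rw [integral_sub (integrable_bounded_mul (hmeas _) (hbd _) _)
      (integrable_bounded_mul (hmeas _) (hbd _) _), dischargePairing, dischargePairing]
    ring
  rw [hsplit]
  have h1 := abs_integral_bounded_mul_le (hbd (I s.toNNReal)) (n s.toNNReal - m s.toNNReal)
  have h2 := abs_integral_bounded_mul_le hdiff (m s.toNNReal)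
  have h3 := hn.abs_activity_sub_le hρ hm hm0 s.toNNReal
  have h4 : L * |I s.toNNReal - J s.toNNReal| * ‖m s.toNNReal‖ ≤
      L * (rM * ‖n s.toNNReal - m s.toNNReal‖) :=
    (mul_le_of_le_one_right (by positivity) (hm1 _)).trans (mul_le_mul_of_nonneg_left h3 hL)
  refine (abs_add_le _ _).trans ?_
  rw [mul_one] at h1
  linarith

theorem IsSolution.norm_sub_le_integral (hρ : IsRegularRate ρ rM L) (hL : 0 ≤ L)
    (hn : IsSolution ρ rM nIni n I) (hm : IsSolution ρ rM nIni m J)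
    (hm0 : ∀ t, ∀ᵐ x ∂ageMeasure, 0 ≤ m t x) (hm1 : ∀ t, ‖m t‖ ≤ 1) (t : ℝ≥0) :
    ‖n t - m t‖ ≤ ∫ s in (0 : ℝ)..t, (2 * rM + L * rM) * ‖n s.toNNReal - m s.toNNReal‖ := by
  refine norm_le_of_forall_integral_le fun ζ hζ hζc hζ1 => ?_
  let η : ℝ → ℝ := fun y => ζ (y + t)
  have hη : ContDiff ℝ ∞ η := hζ.comp (contDiff_id.add contDiff_const)
  have hηc : HasCompactSupport η := hζc.comp_homeomorph (Homeomorph.addRight (t : ℝ))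
  have hη1 : ∀ x, |η x| ≤ 1 := fun x => hζ1 _
  have hζη : ∀ x, ζ x = η (x - t) := fun x => by simp only [η, sub_add_cancel]
  simp_rw [hζη]
  rw [integral_bounded_mul_sub (w := fun x => η (x - t))
    (by have := hη.continuous; fun_prop) (fun x => hη1 _), hn.pairing_eq hρ hη hηc t,
    hm.pairing_eq hρ hη hηc t, sub_sub_sub_cancel_left]
  have hint : ∀ {k : C(ℝ≥0, L1Age)} {A : ℝ≥0 → ℝ}, IsSolution ρ rM nIni k A →
      IntervalIntegrable (fun s => dischargePairing ρ η k A s - A s.toNNReal * η (-s))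
        volume 0 t := fun hk =>
    (((locallyIntegrable_dischargePairing hρ hη.continuous hη1 _ hk.activity_measurable).sub
      (hk.locallyIntegrable_activity_mul hη.continuous)).integrableOn_isCompact
        isCompact_uIcc).intervalIntegrable
  rw [← intervalIntegral.integral_sub (hint hm) (hint hn)]
  refine intervalIntegral.integral_mono_on t.coe_nonneg ((hint hm).sub (hint hn))
    (intervalIntegrable_comp_toNNReal (u := fun s => (2 * rM + L * rM) * ‖n s - m s‖)
      (by fun_prop) _ _) fun s _ => ?_
  have h1 := (abs_le.1 (hn.abs_dischargePairing_sub_le hρ hL hm hm0 hm1 hη.continuous hη1 s)).1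
  have h2 : (I s.toNNReal - J s.toNNReal) * η (-s) ≤ rM * ‖n s.toNNReal - m s.toNNReal‖ := by
    refine (le_abs_self _).trans ?_
    rw [abs_mul]
    exact (mul_le_of_le_one_right (abs_nonneg _) (hη1 _)).trans
      (hn.abs_activity_sub_le hρ hm hm0 _)
  linarith

/-- A solution with nonnegative populations of mass at most one is the only solution. -/
theorem IsSolution.eq_of_nonneg (hρ : IsRegularRate ρ rM L) (hL : 0 ≤ L)
    (hn : IsSolution ρ rM nIni n I) (hm : IsSolution ρ rM nIni m J)
    (hm0 : ∀ t, ∀ᵐ x ∂ageMeasure, 0 ≤ m t x) (hm1 : ∀ t, ‖m t‖ ≤ 1) : n = m ∧ I = J := by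
  set K := 2 * rM + L * rM
  have hD : Continuous fun s : ℝ => K * ‖n s.toNNReal - m s.toNNReal‖ := by
    have := continuous_real_toNNReal
    fun_prop
  set F : ℝ → ℝ := fun t => ∫ s in (0 : ℝ)..t, K * ‖n s.toNNReal - m s.toNNReal‖
  have hK : 0 ≤ K := by
    have := hρ.rM_nonneg
    positivity
  have hFd : ∀ t, HasDerivAt F (K * ‖n t.toNNReal - m t.toNNReal‖) t := fun t =>
    (hD.integral_hasStrictDerivAt 0 t).hasDerivAt
  have hDF : ∀ t : ℝ≥0, ‖n t - m t‖ ≤ F t := hn.norm_sub_le_integral hρ hL hm hm0 hm1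
  have hF0 : ∀ t : ℝ≥0, F t = 0 := fun t =>
    eq_zero_of_abs_deriv_le_mul_abs_self_of_eq_zero_right (K := K) (a := 0) (b := t)
      (fun s _ => (hFd s).continuousAt.continuousWithinAt)
      (fun s _ => (hFd s).hasDerivWithinAt) (by simp [F])
      (fun s hs => by
        lift s to ℝ≥0 using hs.1
        rw [Real.toNNReal_coe, norm_mul, norm_norm, Real.norm_of_nonneg hK]
        exact mul_le_mul_of_nonneg_left ((hDF s).trans (le_abs_self _)) hK)
      t ⟨t.coe_nonneg, le_rfl⟩
  have hnm : ∀ t, ‖n t - m t‖ = 0 := fun t =>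
    le_antisymm ((hDF t).trans (hF0 t).le) (norm_nonneg _)
  refine ⟨ContinuousMap.ext fun t => sub_eq_zero.1 (norm_eq_zero.1 (hnm t)), funext fun t => ?_⟩
  have := hn.abs_activity_sub_le hρ hm hm0 t
  rw [hnm, mul_zero] at this
  exact sub_eq_zero.1 (abs_nonpos_iff.1 this)

end Uniqueness

end TimeElapsed

theorem mainTheorem8 (r : ℝ → ℝ → ℝ) (rM : ℝ) (hrM : 0 < rM)
    (hr : TimeElapsed.IsBoundedRate r rM) (hinh : TimeElapsed.IsInhibitory r rM)
    (nIni : ℝ → ℝ) (hint : IntegrableOn nIni (Ioi 0))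
    (hnonneg : ∀ᵐ x ∂TimeElapsed.ageMeasure, 0 ≤ nIni x)
    (hmass : ∫ x in Ioi (0 : ℝ), nIni x = 1) :
    ∃! p : C(ℝ≥0, TimeElapsed.L1Age) × (ℝ≥0 → ℝ),
      TimeElapsed.IsSolution r rM nIni p.1 p.2 := by
  obtain ⟨ρ, L, hL, hρ, hrρ⟩ := TimeElapsed.exists_isRegularRate hrM.le hr hinh
  obtain ⟨m, J, hm, hm0, hm1⟩ := TimeElapsed.exists_isSolution hρ hrM hL hint hnonneg hmass
  refine ⟨(m, J), hm.congr_rate (hrρ.mono fun x hx z hz => (hx z hz).symm), ?_⟩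
  rintro ⟨n, I⟩ hn
  obtain ⟨h1, h2⟩ := (hn.congr_rate hrρ).eq_of_nonneg hρ hL hm hm0 hm1
  exact Prod.ext h1 h2
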